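/- Let $I=[0,\alpha)$ with $\alpha=1$ or $\alpha=\infty$, equipped with Lebesgue measure $\mu$, and let $L^0$ be the set of classes, modulo equality a.e., of extended real valued measurable functions on $I$. For $x\in L^0$ put $d_x(\lambda)=\mu\{s\in I:|x(s)|>\lambda\}$ for $\lambda\ge 0$, $x^*(t)=\inf\{\lambda>0:d_x(\lambda)\le t\}$ for $t\ge0$, and $x^{**}(t)=\frac1t\int_0^t x^*(s)\,ds$ for $t>0$; put $x^*(\infty)=\lim_{t\to\infty}x^*(t)$ if $\alpha=\infty$ and $x^*(\infty)=0$ if $\alpha=1$. Write $x\prec y$ if $x^{**}(t)\le y^{**}(t)$ for all $t>0$. Let $E$ be a symmetric space on $I$ with the Fatou property. That is, $E\subset L^0$ is a Banach lattice (a sublattice of $L^0$ with a complete norm $\|\cdot\|$) such that: $E$ contains an a.e. strictly positive function; if $x\in L^0$, $y\in E$ and $|x|\le|y|$ a.e., then $x\in E$ and $\|x\|\le\|y\|$; if $x\in L^0$, $y\in E$ and $d_x=d_y$, then $x\in E$ and $\|x\|=\|y\|$; and if $u_n\in E$, $u_n\ge 0$, $\sup_n\|u_n\|<\infty$ and $u_n\uparrow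 u\in L^0$ a.e., then $u\in E$ and $\|u_n\|\uparrow\|u\|$. Let $x\in E$ be a point of lower $K$-monotonicity of $E$, i.e. $\|y\|<\|x\|$ for every $y\in E$ with $y\prec x$ and $y^*\ne x^*$. Assume that $x^*(\infty)=0$, and let $(x_n)_{n\in\mathbb N}\subset E$ satisfy $x_n\prec x$ for all $n$ and $\|x_n\|\to\|x\|$. Then $x_n^{**}\to x^{**}$ and $x_n^*\to x^*$ globally in measure on $I$, i.e. for every $\varepsilon>0$, $\mu\{t\in I:|x_n^{**}(t)-x^{**}(t)|\ge\varepsilon\}\to0$ and $\mu\{t\in I:|x_n^{*}(t)-x^{*}(t)|\ge\varepsilon\}\to0$ as $n\to\infty$. -/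

import Mathlib

open MeasureTheory Filter Topology
open scoped NNReal ENNReal

namespace SymSpace

/-- The interval `I = [0, α)`, as a subset of the real line. -/
def I (α : ℝ≥0∞) : Set ℝ := {t : ℝ | 0 ≤ t ∧ ENNReal.ofReal t < α}

/-- Lebesgue measure on `I = [0, α)`. -/
noncomputable def leb (α : ℝ≥0∞) : Measure ℝ := volume.restrict (I α)

/-- Classes (modulo equality a.e.) of real-valued measurable functions on `[0, α)`.
Elements of a Banach function space are finite a.e., so real values suffice. -/
abbrev L0 (α : ℝ≥0∞) : Type := ℝ →ₘ[leb α] ℝ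

/-- The distribution function `d_x(lam) = μ {s ∈ I : |x s| > lam}`, `lam ≥ 0`. -/
noncomputable def distribution {α : ℝ≥0∞} (x : L0 α) (lam : ℝ≥0) : ℝ≥0∞ :=
  leb α {s : ℝ | (lam : ℝ) < |x s|}

/-- The decreasing rearrangement `x*(t) = inf {lam > 0 : d_x(lam) ≤ t}`, `t ≥ 0`, with values in
`[0, ∞]` (the infimum of the empty set is `∞`). -/
noncomputable def rearr {α : ℝ≥0∞} (x : L0 α) (t : ℝ) : ℝ≥0∞ :=
  ⨅ (lam : ℝ≥0) (_ : 0 < lam ∧ distribution x lam ≤ ENNReal.ofReal t), (lam : ℝ≥0∞)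

/-- The maximal function `x**(t) = (1/t) ∫₀ᵗ x*(s) ds`, `t > 0`. -/
noncomputable def maximal {α : ℝ≥0∞} (x : L0 α) (t : ℝ) : ℝ≥0∞ :=
  (∫⁻ s in Set.Ioo 0 t, rearr x s) / ENNReal.ofReal t

/-- The condition `x*(∞) = 0`, where `x*(∞) = lim_{t → ∞} x*(t)` if `α = ∞`, and `x*(∞) = 0` by
convention if `α = 1`. -/
def RearrVanishesAtInfinity {α : ℝ≥0∞} (x : L0 α) : Prop :=
  α = ∞ → Tendsto (rearr x) atTop (𝓝 0)

/-- The Hardy-Littlewood-Polya relation `x ≺ y`. -/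
def HLP {α : ℝ≥0∞} (x y : L0 α) : Prop :=
  ∀ t : ℝ, 0 < t → maximal x t ≤ maximal y t

/-- `x` and `y` are equimeasurable. -/
def Equimeasurable {α : ℝ≥0∞} (x y : L0 α) : Prop :=
  ∀ lam : ℝ≥0, distribution x lam = distribution y lam

/-- A Banach function space (Koethe space) on `[0, α)`: a linear subspace of `L⁰` with a complete
norm, which is an ideal with monotone norm and contains an a.e. strictly positive element. -/
structure BanachFunctionSpace (α : ℝ≥0∞) where
  carrier : Submodule ℝ (L0 α)
  nrm : Seminorm ℝ carrier
  eq_zero_of_nrm : ∀ x : carrier, nrm x = 0 → x = 0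
  complete : ∀ u : ℕ → carrier,
    (∀ ε : ℝ, 0 < ε → ∃ N, ∀ m ≥ N, ∀ n ≥ N, nrm (u m - u n) < ε) →
      ∃ x : carrier, Tendsto (fun n => nrm (u n - x)) atTop (𝓝 0)
  ideal : ∀ (x : L0 α) (y : carrier), (∀ᵐ t ∂(leb α), |x t| ≤ |(y : L0 α) t|) →
    ∃ hx : x ∈ carrier, nrm ⟨x, hx⟩ ≤ nrm y
  exists_pos : ∃ x : carrier, ∀ᵐ t ∂(leb α), 0 < (x : L0 α) t

namespace BanachFunctionSpace

variable {α : ℝ≥0∞}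

/-- `E` is symmetric (rearrangement invariant). -/
def IsSymmetric (E : BanachFunctionSpace α) : Prop :=
  ∀ (x : L0 α) (y : E.carrier), Equimeasurable x (y : L0 α) →
    ∃ hx : x ∈ E.carrier, E.nrm ⟨x, hx⟩ = E.nrm y

/-- The Fatou property: if `0 ≤ uₙ ↑ x` a.e. with `uₙ ∈ E`, `sup ‖uₙ‖ < ∞`, then `x ∈ E` and
`‖uₙ‖ → ‖x‖`. -/
def HasFatouProperty (E : BanachFunctionSpace α) : Prop :=
  ∀ (u : ℕ → E.carrier) (x : L0 α),
    (∀ n, ∀ᵐ t ∂(leb α), 0 ≤ (u n : L0 α) t) →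
    (∀ n, ∀ᵐ t ∂(leb α), (u n : L0 α) t ≤ (u (n + 1) : L0 α) t) →
    (∀ᵐ t ∂(leb α), Tendsto (fun n => (u n : L0 α) t) atTop (𝓝 (x t))) →
    BddAbove (Set.range fun n => E.nrm (u n)) →
      ∃ hx : x ∈ E.carrier, Tendsto (fun n => E.nrm (u n)) atTop (𝓝 (E.nrm ⟨x, hx⟩))

/-- `x` is a point of lower `K`-monotonicity (an `LKM` point) of `E`. -/
def IsLKMPoint (E : BanachFunctionSpace α) (x : E.carrier) : Prop :=
  ∀ y : E.carrier, rearr (x : L0 α) ≠ rearr (y : L0 α) → HLP (y : L0 α) (x : L0 α) →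
    E.nrm y < E.nrm x

end BanachFunctionSpace

end SymSpace

/-! Write Φ_y(t) = ∫₀ᵗ y* (`prim`). It is concave with slope y*, and y ≺ x means Φ_y ≤ Φ_x.

The crux is that Φ_{x_n}(t₀) → Φ_x(t₀) (`tendsto_prim`). If this fails, compactness of the pairs
(value, slope) at t₀ puts infinitely many Φ_{x_n} below one line that passes strictly below Φ_x(t₀)
at t₀. The minimum of Φ_x and that line is concave, so on I it equals Φ_y for some y
(`exists_prim_eq_min`). Then y ≺ x and y* ≠ x*, so ‖y‖ < ‖x‖. But x_n ≺ y infinitely often gives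
‖x_n‖ ≤ ‖y‖, which contradicts ‖x_n‖ → ‖x‖.

This uses that the norm is monotone for ≺ (`inBall_of_prim_le`): a majorized vector lies below a
convex combination of permutations, which settles step functions on a uniform grid, and the Fatou
property passes to the limit. Finiteness of Φ_x also comes from the LKM property, since otherwise 2x
≺ x.

By concavity, convergence of the Φ's forces convergence of slopes wherever x* is continuous. All
functions involved are dominated by x**, which vanishes at infinity, so tails are uniformly small
and a.e. convergence becomes global convergence in measure. -/

namespace SymSpace

variable {α : ℝ≥0∞}

/-! ### Distribution functions and decreasing rearrangements -/

lemma measurableSet_I (α : ℝ≥0∞) : MeasurableSet (I α) := by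
  have : I α = Set.Ici 0 ∩ ENNReal.ofReal ⁻¹' Set.Iio α := by
    ext t; simp [I]
  rw [this]
  exact measurableSet_Ici.inter (ENNReal.measurable_ofReal measurableSet_Iio)

lemma volume_I (d : ℝ≥0∞) : volume (I d) = d := by
  rcases eq_or_ne d ∞ with rfl | hd
  · have : I ∞ = Set.Ici 0 := by ext t; simp [I]
    simp [this]
  · have : I d = Set.Ico 0 d.toReal := by
      ext t
      simp only [I, Set.mem_ofPred_eq, Set.mem_Ico]
      refine and_congr_right fun h => ?_
      rw [ENNReal.ofReal_lt_iff_lt_toReal h hd]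
    rw [this, Real.volume_Ico, sub_zero, ENNReal.ofReal_toReal hd]

lemma distribution_le (x : L0 α) (lam : ℝ≥0) : distribution x lam ≤ α := by
  calc distribution x lam ≤ leb α Set.univ := measure_mono (Set.subset_univ _)
    _ = α := by rw [leb, Measure.restrict_apply_univ, volume_I]

lemma distribution_anti (x : L0 α) {a b : ℝ≥0} (h : a ≤ b) :
    distribution x b ≤ distribution x a :=
  measure_mono fun s (hs : (b : ℝ) < |x s|) =>
    show (a : ℝ) < |x s| from lt_of_le_of_lt (by exact_mod_cast h) hs

lemma distribution_mk {f : ℝ → ℝ} (hf : AEStronglyMeasurable f (leb α)) (lam : ℝ≥0) :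
    distribution (AEEqFun.mk f hf) lam = leb α {s | (lam : ℝ) < |f s|} := by
  refine measure_congr ?_
  filter_upwards [AEEqFun.coeFn_mk f hf] with s hs
  change ((lam : ℝ) < |AEEqFun.mk f hf s|) = ((lam : ℝ) < |f s|)
  rw [hs]

/-- Continuity of the measure along increasing sets makes the distribution right continuous, so the
infimum is attained. This also covers `lam = 0`, which the infimum excludes. -/
lemma rearr_le_iff (x : L0 α) (lam : ℝ≥0) (t : ℝ) :
    rearr x t ≤ lam ↔ distribution x lam ≤ ENNReal.ofReal t := by
  constructor
  · intro h
    by_contra! hlt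
    have hU : {s : ℝ | (lam : ℝ) < |x s|}
        = ⋃ n : ℕ, {s : ℝ | ((lam + 1 / (n + 1 : ℝ≥0) : ℝ≥0) : ℝ) < |x s|} := by
      ext s
      simp only [Set.mem_ofPred_eq, Set.mem_iUnion]
      constructor
      · intro hs
        obtain ⟨n, hn⟩ := exists_nat_one_div_lt (sub_pos.2 hs)
        refine ⟨n, ?_⟩
        push_cast
        linarith
      · rintro ⟨n, hn⟩
        refine lt_of_le_of_lt ?_ hn
        push_cast
        have : (0 : ℝ) ≤ 1 / ((n : ℝ) + 1) := by positivity
        linarith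
    have hmono : Monotone fun n : ℕ =>
        {s : ℝ | ((lam + 1 / (n + 1 : ℝ≥0) : ℝ≥0) : ℝ) < |x s|} := by
      intro m n hmn s hs
      have hs' : ((lam + 1 / (m + 1 : ℝ≥0) : ℝ≥0) : ℝ) < |x s| := hs
      refine lt_of_le_of_lt ?_ hs'
      push_cast
      gcongr
    have hd : distribution x lam = ⨆ n : ℕ, distribution x (lam + 1 / (n + 1 : ℝ≥0)) := by
      simp only [distribution]
      rw [hU]
      exact hmono.measure_iUnion
    rw [hd] at hlt
    obtain ⟨n, hn⟩ := lt_iSup_iff.1 hlt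
    have : ((lam + 1 / (n + 1 : ℝ≥0) : ℝ≥0) : ℝ≥0∞) ≤ rearr x t := by
      refine le_iInf₂ fun mu hmu => ?_
      by_contra! hc
      have hc' : mu ≤ lam + 1 / (n + 1 : ℝ≥0) := by exact_mod_cast hc.le
      exact absurd (lt_of_lt_of_le hn (distribution_anti x hc')) (not_lt.2 hmu.2)
    have h2 : lam + 1 / (n + 1 : ℝ≥0) ≤ lam := by exact_mod_cast this.trans h
    have h3 : (0 : ℝ≥0) < 1 / (n + 1 : ℝ≥0) := by positivity
    exact absurd h2 (not_le.2 (lt_add_of_pos_right _ h3))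
  · intro h
    refine ENNReal.le_of_forall_pos_le_add fun e he _ => ?_
    refine iInf₂_le_of_le (lam + e) ⟨by positivity, ?_⟩ (by simp)
    exact (distribution_anti x (by simp)).trans h

lemma lt_rearr_iff (x : L0 α) (lam : ℝ≥0) (t : ℝ) :
    (lam : ℝ≥0∞) < rearr x t ↔ ENNReal.ofReal t < distribution x lam := by
  rw [← not_le, rearr_le_iff, not_le]

lemma rearr_antitone (x : L0 α) : Antitone (rearr x) := fun _ _ hst =>
  le_iInf₂ fun lam h => iInf₂_le lam ⟨h.1, h.2.trans (ENNReal.ofReal_le_ofReal hst)⟩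

lemma rearr_eq_zero_of_le (x : L0 α) {t : ℝ} (h : α ≤ ENNReal.ofReal t) : rearr x t = 0 := by
  have := (rearr_le_iff x 0 t).2 ((distribution_le x 0).trans h)
  simpa using this

/-- Values of `rearr x` slightly to the right of `t` exceed any number below `rearr x t`. -/
lemma exists_lt_rearr_right (x : L0 α) {lam : ℝ≥0} {t : ℝ} (ht : 0 ≤ t)
    (h : (lam : ℝ≥0∞) < rearr x t) : ∃ t' > t, (lam : ℝ≥0∞) < rearr x t' := by
  rw [lt_rearr_iff] at h
  obtain ⟨c, hc, hc'⟩ := exists_between h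
  have hctop : c ≠ ∞ := (lt_of_lt_of_le hc' le_top).ne
  refine ⟨c.toReal, ?_, ?_⟩
  · exact (ENNReal.ofReal_lt_iff_lt_toReal ht hctop).1 hc
  · rw [lt_rearr_iff, ENNReal.ofReal_toReal hctop]
    exact hc'

/-! ### Primitives of the rearrangement and their slope bounds -/

/-- The integral of the decreasing rearrangement over `(0, t)`. -/
noncomputable def rearrInt (x : L0 α) (t : ℝ) : ℝ≥0∞ := ∫⁻ s in Set.Ioo 0 t, rearr x s

lemma rearrInt_mono (x : L0 α) : Monotone (rearrInt x) := fun _ _ h =>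
  lintegral_mono_set (Set.Ioo_subset_Ioo_right h)

lemma hlp_iff {x y : L0 α} : HLP x y ↔ ∀ t : ℝ, 0 < t → rearrInt x t ≤ rearrInt y t := by
  refine forall₂_congr fun t ht => ?_
  have h0 : ENNReal.ofReal t ≠ 0 := by simpa using ht
  rw [maximal, maximal, ENNReal.div_le_iff h0 ENNReal.ofReal_ne_top,
    ENNReal.div_mul_cancel h0 ENNReal.ofReal_ne_top, rearrInt, rearrInt]

/-- Finiteness of the integrals of the rearrangement. -/
def LocInt (x : L0 α) : Prop := ∀ t : ℝ, rearrInt x t < ∞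

lemma LocInt.of_hlp {x y : L0 α} (hy : LocInt y) (h : HLP x y) : LocInt x := by
  intro t
  rcases le_or_gt t 0 with ht | ht
  · simp [rearrInt, Set.Ioo_eq_empty (not_lt.2 ht)]
  · exact (hlp_iff.1 h t ht).trans_lt (hy t)

lemma mul_rearr_le (x : L0 α) {s t : ℝ} :
    ENNReal.ofReal (t - s) * rearr x t ≤ ∫⁻ r in Set.Ioo s t, rearr x r := by
  calc ENNReal.ofReal (t - s) * rearr x t = ∫⁻ r in Set.Ioo s t, rearr x t := by
        rw [setLIntegral_const, Real.volume_Ioo, mul_comm]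
    _ ≤ _ := setLIntegral_mono' measurableSet_Ioo fun r hr => rearr_antitone x hr.2.le

lemma le_mul_rearr (x : L0 α) {s t : ℝ} :
    ∫⁻ r in Set.Ioo s t, rearr x r ≤ ENNReal.ofReal (t - s) * rearr x s := by
  calc _ ≤ ∫⁻ r in Set.Ioo s t, rearr x s :=
        setLIntegral_mono' measurableSet_Ioo fun r hr => rearr_antitone x hr.1.le
    _ = _ := by rw [setLIntegral_const, Real.volume_Ioo, mul_comm]

lemma LocInt.rearr_lt_top {x : L0 α} (hx : LocInt x) {t : ℝ} (ht : 0 < t) : rearr x t < ∞ := by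
  have h := (mul_rearr_le x (s := 0) (t := t)).trans_lt (hx t)
  by_contra hc
  rw [not_lt, top_le_iff] at hc
  rw [hc, sub_zero, ENNReal.mul_top (by simpa using ht)] at h
  exact lt_irrefl _ h

/-- The real-valued decreasing rearrangement. -/
noncomputable def rr (x : L0 α) (t : ℝ) : ℝ := (rearr x t).toReal

/-- The primitive of the real-valued decreasing rearrangement. -/
noncomputable def prim (x : L0 α) (t : ℝ) : ℝ := (rearrInt x t).toReal

lemma rr_nonneg (x : L0 α) (t : ℝ) : 0 ≤ rr x t := ENNReal.toReal_nonneg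

lemma LocInt.ofReal_rr {x : L0 α} (hx : LocInt x) {t : ℝ} (ht : 0 < t) :
    ENNReal.ofReal (rr x t) = rearr x t := ENNReal.ofReal_toReal (hx.rearr_lt_top ht).ne

lemma LocInt.ofReal_prim {x : L0 α} (hx : LocInt x) (t : ℝ) :
    ENNReal.ofReal (prim x t) = rearrInt x t := ENNReal.ofReal_toReal (hx t).ne

lemma LocInt.rr_antitone {x : L0 α} (hx : LocInt x) {s t : ℝ} (hs : 0 < s) (hst : s ≤ t) :
    rr x t ≤ rr x s :=
  ENNReal.toReal_mono (hx.rearr_lt_top hs).ne (rearr_antitone x hst)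

lemma measurable_rearr (x : L0 α) : Measurable (rearr x) := (rearr_antitone x).measurable

lemma measurable_rr (x : L0 α) : Measurable (rr x) := (measurable_rearr x).ennreal_toReal

lemma rearrInt_add (x : L0 α) {s t : ℝ} (hs : 0 ≤ s) (hst : s ≤ t) :
    rearrInt x t = rearrInt x s + ∫⁻ r in Set.Ioo s t, rearr x r := by
  rw [rearrInt, rearrInt, setLIntegral_congr (Ioo_ae_eq_Ioc (a := (0 : ℝ)) (b := t)),
    setLIntegral_congr (Ioo_ae_eq_Ioc (a := (0 : ℝ)) (b := s)),
    setLIntegral_congr (Ioo_ae_eq_Ioc (a := s) (b := t)),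
    ← lintegral_union measurableSet_Ioc, Set.Ioc_union_Ioc_eq_Ioc hs hst]
  exact Set.disjoint_left.2 fun r h1 h2 => absurd h1.2 (not_le.2 h2.1)

/-- With `LocInt.le_mul_rr`, this is the form in which concavity of the primitive is used
throughout. -/
lemma LocInt.mul_rr_le {x : L0 α} (hx : LocInt x) {s t : ℝ} (hs : 0 ≤ s) (hst : s ≤ t) :
    (t - s) * rr x t ≤ prim x t - prim x s := by
  have h := mul_rearr_le x (s := s) (t := t)
  have h1 := rearrInt_add x hs hst
  have hfin : (∫⁻ r in Set.Ioo s t, rearr x r) ≠ ∞ := by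
    intro hc; rw [hc, add_top] at h1; exact (hx t).ne h1
  have h2 : prim x t = prim x s + (∫⁻ r in Set.Ioo s t, rearr x r).toReal := by
    rw [prim, h1, ENNReal.toReal_add (hx s).ne hfin, prim]
  have h3 := ENNReal.toReal_mono hfin h
  rw [ENNReal.toReal_mul, ENNReal.toReal_ofReal (sub_nonneg.2 hst)] at h3
  rw [h2, add_sub_cancel_left]
  exact h3

/-- Here `s = 0` must be excluded: `rearr x 0` may be `∞`, and `toReal` would turn it into `0`. -/
lemma LocInt.le_mul_rr {x : L0 α} (hx : LocInt x) {s t : ℝ} (hs : 0 < s) (hst : s ≤ t) :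
    prim x t - prim x s ≤ (t - s) * rr x s := by
  have h := le_mul_rearr x (s := s) (t := t)
  have h1 := rearrInt_add x hs.le hst
  have hfin : (∫⁻ r in Set.Ioo s t, rearr x r) ≠ ∞ := by
    intro hc; rw [hc, add_top] at h1; exact (hx t).ne h1
  have h2 : prim x t = prim x s + (∫⁻ r in Set.Ioo s t, rearr x r).toReal := by
    rw [prim, h1, ENNReal.toReal_add (hx s).ne hfin, prim]
  have h3 := ENNReal.toReal_mono (ENNReal.mul_ne_top ENNReal.ofReal_ne_top
    (hx.rearr_lt_top hs).ne) h
  rw [ENNReal.toReal_mul, ENNReal.toReal_ofReal (sub_nonneg.2 hst)] at h3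
  rw [h2, add_sub_cancel_left]
  exact h3

lemma prim_zero (x : L0 α) : prim x 0 = 0 := by simp [prim, rearrInt]

lemma prim_nonneg (x : L0 α) (t : ℝ) : 0 ≤ prim x t := ENNReal.toReal_nonneg

lemma LocInt.prim_mono {x : L0 α} (hx : LocInt x) : Monotone (prim x) := fun _ t h =>
  ENNReal.toReal_mono (hx t).ne (rearrInt_mono x h)

lemma LocInt.prim_le {x y : L0 α} (hy : LocInt y) (h : HLP x y) {t : ℝ} (ht : 0 < t) :
    prim x t ≤ prim y t :=
  ENNReal.toReal_mono (hy t).ne (hlp_iff.1 h t ht)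

lemma LocInt.tendsto_prim_zero {x : L0 α} (hx : LocInt x) :
    Tendsto (prim x) (𝓝[>] 0) (𝓝 0) := by
  have hint : IntegrableOn (rr x) (Set.Ioc 0 1) := by
    refine integrable_toReal_of_lintegral_ne_top (measurable_rearr x).aemeasurable ?_
    rw [← setLIntegral_congr (Ioo_ae_eq_Ioc (a := (0 : ℝ)) (b := 1))]
    exact (hx 1).ne
  have hII : IntervalIntegrable (rr x) volume 0 1 :=
    (intervalIntegrable_iff_integrableOn_Ioc_of_le zero_le_one).2 hint
  have hc := intervalIntegral.continuousOn_primitive_interval'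
    (μ := volume) hII (Set.left_mem_uIcc)
  have h0 : ContinuousWithinAt (fun b => ∫ s in (0 : ℝ)..b, rr x s) (Set.uIcc 0 1) 0 :=
    hc 0 Set.left_mem_uIcc
  have h1 : Tendsto (fun b => ∫ s in (0 : ℝ)..b, rr x s) (𝓝[>] 0) (𝓝 0) := by
    have := h0.tendsto
    rw [intervalIntegral.integral_same, Set.uIcc_of_le zero_le_one] at this
    refine this.mono_left ?_
    rw [← nhdsWithin_Ioc_eq_nhdsGT (zero_lt_one' ℝ)]
    exact nhdsWithin_mono _ Set.Ioc_subset_Icc_self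
  refine h1.congr' ?_
  filter_upwards [self_mem_nhdsWithin] with b hb
  rw [intervalIntegral.integral_of_le (le_of_lt hb), prim, rearrInt,
    setLIntegral_congr (Ioo_ae_eq_Ioc (a := (0 : ℝ)) (b := b))]
  refine integral_toReal (measurable_rearr x).aemeasurable ?_
  rw [ae_restrict_iff' measurableSet_Ioc]
  exact Eventually.of_forall fun s hs => hx.rearr_lt_top hs.1

/-! ### The rearrangement as an element of `L0` -/

/-- The class of the real-valued decreasing rearrangement. -/
noncomputable def star (x : L0 α) : L0 α :=
  AEEqFun.mk (rr x) (measurable_rr x).aestronglyMeasurable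

lemma ae_leb_pos : ∀ᵐ t ∂(leb α), 0 < t := by
  rw [leb, ae_restrict_iff' (measurableSet_I α)]
  have : ∀ᵐ t : ℝ, t ≠ 0 := by simp [ae_iff]
  filter_upwards [this] with t ht h
  exact lt_of_le_of_ne h.1 ht.symm

lemma ae_leb_mem : ∀ᵐ t ∂(leb α), t ∈ I α := ae_restrict_mem (measurableSet_I α)

/-- Up to a null set, the superlevel set of x* at `lam` is the interval [0, d_x(lam)). -/
lemma LocInt.equimeasurable_star {x : L0 α} (hx : LocInt x) : Equimeasurable (star x) x := by
  intro lam
  rw [star, distribution_mk]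
  have h1 : {s | (lam : ℝ) < |rr x s|} =ᵐ[leb α] I (distribution x lam) := by
    filter_upwards [ae_leb_pos] with s hs
    refine propext ?_
    change (lam : ℝ) < |rr x s| ↔ 0 ≤ s ∧ _
    rw [← lt_rearr_iff, abs_of_nonneg (rr_nonneg _ _), rr,
      ← ENNReal.ofReal_lt_iff_lt_toReal lam.coe_nonneg (hx.rearr_lt_top hs).ne, ENNReal.ofReal_coe_nnreal]
    exact (and_iff_right hs.le).symm
  rw [measure_congr h1, leb, Measure.restrict_apply (measurableSet_I _),
    Set.inter_eq_left.2, volume_I]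
  exact fun t ht => ⟨ht.1, ht.2.trans_le (distribution_le x lam)⟩

/-! ### Finite-dimensional majorization -/

/-- Weighted Abel summation: dominance of partial sums gives dominance of sums with
nonnegative decreasing weights. -/
lemma sum_mul_le_of_partial_sums {w a b : ℕ → ℝ} {L : ℕ}
    (hw : ∀ i < L, 0 ≤ w i) (hanti : ∀ i j, i ≤ j → j < L → w j ≤ w i)
    (h : ∀ l ≤ L, ∑ i ∈ Finset.range l, a i ≤ ∑ i ∈ Finset.range l, b i) :
    ∑ i ∈ Finset.range L, w i * a i ≤ ∑ i ∈ Finset.range L, w i * b i := by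
  rcases Nat.eq_zero_or_pos L with rfl | hL
  · simp
  have key : ∀ l, l < L → w l * (∑ i ∈ Finset.range (l + 1), (b i - a i)) ≤
      ∑ i ∈ Finset.range (l + 1), w i * (b i - a i) := by
    intro l
    induction l with
    | zero => intro _; simp
    | succ l ih =>
      intro hl
      have h1 := ih (by omega)
      rw [Finset.sum_range_succ _ (l + 1), Finset.sum_range_succ _ (l + 1), mul_add]
      have h2 : 0 ≤ ∑ i ∈ Finset.range (l + 1), (b i - a i) := by
        rw [Finset.sum_sub_distrib]; exact sub_nonneg.2 (h _ (by omega))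
      have h3 := mul_le_mul_of_nonneg_right (hanti l (l + 1) (by omega) hl) h2
      linarith
  have h1 := key (L - 1) (by omega)
  rw [Nat.sub_add_cancel hL] at h1
  have h2 : 0 ≤ ∑ i ∈ Finset.range L, (b i - a i) := by
    rw [Finset.sum_sub_distrib]; exact sub_nonneg.2 (h _ le_rfl)
  have h3 := mul_nonneg (hw (L - 1) (by omega)) h2
  have h4 : ∑ i ∈ Finset.range L, w i * (b i - a i)
      = ∑ i ∈ Finset.range L, w i * b i - ∑ i ∈ Finset.range L, w i * a i := by
    rw [← Finset.sum_sub_distrib]; exact Finset.sum_congr rfl fun i _ => by ring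
  linarith

/-- Hardy-Littlewood-Polya: a decreasing vector weakly majorized by `b` lies below a convex
combination of permutations of `b`. -/
theorem exists_mem_convexHull_perm {L : ℕ} {a b : ℕ → ℝ}
    (ha : ∀ i j, i ≤ j → j < L → a j ≤ a i)
    (h : ∀ l ≤ L, ∑ i ∈ Finset.range l, a i ≤ ∑ i ∈ Finset.range l, b i) :
    ∃ c ∈ convexHull ℝ (Set.range fun σ : Equiv.Perm (Fin L) => fun i : Fin L => b (σ i)),
      ∀ i : Fin L, a i ≤ c i := by
  by_contra! hcon
  set S := convexHull ℝ (Set.range fun σ : Equiv.Perm (Fin L) => fun i : Fin L => b (σ i))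
  set T : Set (Fin L → ℝ) := Set.Ici (fun i : Fin L => a i)
  have hdisj : Disjoint S T := by
    rw [Set.disjoint_left]
    intro c hc hcT
    obtain ⟨i, hi⟩ := hcon c hc
    exact absurd (hcT i) (not_le.2 hi)
  -- If no such `c` exists, a functional strictly separates the compact hull from the closed orthant
  -- above `a`.
  obtain ⟨f, u, v, hfS, huv, hfT⟩ := geometric_hahn_banach_compact_closed
    (convex_convexHull ℝ _) ((Set.finite_range _).isCompact_convexHull ℝ)
    (convex_Ici (𝕜 := ℝ) _) isClosed_Ici hdisj
  set g : Fin L → ℝ := fun i => f (Pi.single i 1) with hg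
  have hf : ∀ c : Fin L → ℝ, f c = ∑ i, g i * c i := by
    intro c
    conv_lhs => rw [pi_eq_sum_univ' c]
    rw [map_sum]
    refine Finset.sum_congr rfl fun i _ => ?_
    rw [map_smul, smul_eq_mul, mul_comm, hg]
  have hg0 : ∀ i, 0 ≤ g i := by
    intro i
    by_contra! hi
    -- With a negative weight, this step up coordinate `i` stays in the orthant and brings `f` down
    -- to exactly `v`.
    set r : ℝ := (v - f (fun i : Fin L => a i)) / g i with hr
    have hva : v < f (fun i : Fin L => a i) := hfT _ (Set.mem_Ici.2 le_rfl)
    have hrpos : 0 < r := div_pos_of_neg_of_neg (by linarith) hi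
    have h1 := hfT ((fun i : Fin L => a i) + r • Pi.single i 1) (Set.mem_Ici.2 (by
      refine le_add_of_nonneg_right (smul_nonneg hrpos.le ?_)
      exact Pi.single_nonneg.2 zero_le_one))
    rw [map_add, map_smul, smul_eq_mul] at h1
    change v < f (fun i : Fin L => a i) + r * g i at h1
    rw [hr, div_mul_cancel₀ _ hi.ne] at h1
    linarith
  -- sort the weights decreasingly
  set τ : Equiv.Perm (Fin L) := Tuple.sort (fun i => - g i) with hτ
  have hmono : Antitone (g ∘ τ) := by
    intro i j hij
    have := Tuple.monotone_sort (fun i => - g i) hij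
    simpa using this
  set w : ℕ → ℝ := fun i => if hi : i < L then g (τ ⟨i, hi⟩) else 0 with hw
  have hwf : ∀ i : Fin L, w i = g (τ i) := fun i => by simp [hw]
  have habel := sum_mul_le_of_partial_sums (w := w) (a := a) (b := b) (L := L)
    (fun i hi => by simp only [hw, dif_pos hi]; exact hg0 _)
    (fun i j hij hj => by
      simp only [hw, dif_pos hj, dif_pos (lt_of_le_of_lt hij hj)]
      exact hmono (Fin.mk_le_mk.2 hij)) h
  rw [← Fin.sum_univ_eq_sum_range (fun i => w i * a i),
    ← Fin.sum_univ_eq_sum_range (fun i => w i * b i)] at habel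
  simp only [hwf] at habel
  have hb : ∑ i : Fin L, g (τ i) * b i < u := by
    have := hfS (fun i : Fin L => b (τ.symm i)) (subset_convexHull ℝ _ ⟨τ.symm, rfl⟩)
    rw [hf] at this
    rwa [← Equiv.sum_comp τ, Finset.sum_congr rfl fun i _ => by rw [Equiv.symm_apply_apply]]
      at this
  -- By the rearrangement inequality, pairing `a` with the sorted weights only increases the sum.
  -- Hence f(a) ≤ ∑ g(τ i) a i ≤ ∑ g(τ i) b i < u < v < f(a).
  have hvary : Monovary (fun i : Fin L => a i) (g ∘ τ) := by
    intro i j hij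
    have : j < i := by
      by_contra! hc
      exact absurd (hmono hc) (not_le.2 hij)
    exact ha _ _ this.le i.2
  have hre := hvary.sum_mul_comp_perm_le_sum_mul (σ := τ.symm)
  have hva : v < f (fun i : Fin L => a i) := hfT _ (Set.mem_Ici.2 le_rfl)
  rw [hf] at hva
  simp only [Function.comp_apply, Equiv.apply_symm_apply] at hre
  have e1 : ∑ i : Fin L, g i * a i = ∑ i : Fin L, a i * g i :=
    Finset.sum_congr rfl fun i _ => mul_comm _ _
  have e2 : ∑ i : Fin L, g (τ i) * a i = ∑ i : Fin L, a i * g (τ i) :=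
    Finset.sum_congr rfl fun i _ => mul_comm _ _
  linarith

/-! ### Step functions on a uniform grid -/

/-- The step function with value `c i` on `[iδ, (i+1)δ)`. -/
noncomputable def stepFun (δ : ℝ) {L : ℕ} (c : Fin L → ℝ) (t : ℝ) : ℝ :=
  if h : 0 ≤ t ∧ ⌊t / δ⌋₊ < L then c ⟨⌊t / δ⌋₊, h.2⟩ else 0

lemma stepFun_eq_sum (δ : ℝ) {L : ℕ} (c : Fin L → ℝ) (t : ℝ) :
    stepFun δ c t = ∑ i : Fin L, if 0 ≤ t ∧ ⌊t / δ⌋₊ = i then c i else 0 := by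
  unfold stepFun
  split_ifs with h
  · rw [Finset.sum_eq_single ⟨⌊t / δ⌋₊, h.2⟩]
    · simp [h.1]
    · intro i _ hi
      rw [if_neg]
      rintro ⟨_, h2⟩
      exact hi (Fin.ext h2.symm)
    · simp
  · symm
    refine Finset.sum_eq_zero fun i _ => if_neg ?_
    rintro ⟨h1, h2⟩
    exact h ⟨h1, h2 ▸ i.2⟩

lemma measurable_stepFun (δ : ℝ) {L : ℕ} (c : Fin L → ℝ) : Measurable (stepFun δ c) := by
  have : stepFun δ c = fun t => ∑ i : Fin L, if 0 ≤ t ∧ ⌊t / δ⌋₊ = i then c i else 0 :=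
    funext (stepFun_eq_sum δ c)
  rw [this]
  refine Finset.measurable_sum _ fun i _ => Measurable.ite ?_ measurable_const measurable_const
  refine measurableSet_Ici.inter ?_
  exact (Nat.measurable_floor.comp (measurable_id.div_const δ)) (measurableSet_singleton (i : ℕ))

/-- The class of a step function. -/
noncomputable def step (α : ℝ≥0∞) (δ : ℝ) {L : ℕ} (c : Fin L → ℝ) : L0 α :=
  AEEqFun.mk (stepFun δ c) (measurable_stepFun δ c).aestronglyMeasurable

lemma coeFn_step (δ : ℝ) {L : ℕ} (c : Fin L → ℝ) : step α δ c =ᵐ[leb α] stepFun δ c :=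
  AEEqFun.coeFn_mk _ _

lemma stepFun_add_smul (δ : ℝ) {L : ℕ} (p q : ℝ) (c d : Fin L → ℝ) (t : ℝ) :
    stepFun δ (p • c + q • d) t = p * stepFun δ c t + q * stepFun δ d t := by
  unfold stepFun
  split_ifs <;> simp

lemma step_add_smul (δ : ℝ) {L : ℕ} (p q : ℝ) (c d : Fin L → ℝ) :
    step α δ (p • c + q • d) = p • step α δ c + q • step α δ d := by
  refine AEEqFun.ext ?_
  filter_upwards [coeFn_step (α := α) δ (p • c + q • d), coeFn_step (α := α) δ c,
    coeFn_step (α := α) δ d, AEEqFun.coeFn_add (p • step α δ c) (q • step α δ d),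
    AEEqFun.coeFn_smul p (step α δ c), AEEqFun.coeFn_smul q (step α δ d)]
    with t h1 h2 h3 h4 h5 h6
  rw [h1, h4, Pi.add_apply, h5, h6, Pi.smul_apply, Pi.smul_apply, h2, h3, stepFun_add_smul,
    smul_eq_mul, smul_eq_mul]

lemma floor_cell {δ t : ℝ} (hδ : 0 < δ) (i : ℕ) :
    (0 ≤ t ∧ ⌊t / δ⌋₊ = i) ↔ t ∈ Set.Ico (i * δ) ((i + 1) * δ) := by
  rw [Set.mem_Ico, ← le_div_iff₀ hδ, ← div_lt_iff₀ hδ]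
  constructor
  · rintro ⟨h0, h⟩
    exact (Nat.floor_eq_iff (by positivity)).1 h
  · intro h
    have h1 : 0 ≤ t / δ := (Nat.cast_nonneg i).trans h.1
    have h0 : 0 ≤ t := by
      by_contra! hc
      exact absurd h1 (not_le.2 (div_neg_of_neg_of_pos hc hδ))
    exact ⟨h0, (Nat.floor_eq_iff h1).2 h⟩

lemma distribution_step {δ : ℝ} (hδ : 0 < δ) {L : ℕ} (hL : ENNReal.ofReal (L * δ) ≤ α)
    (c : Fin L → ℝ) (lam : ℝ≥0) :
    distribution (step α δ c) lam = ∑ i : Fin L, if (lam : ℝ) < |c i| then ENNReal.ofReal δ else 0 := by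
  rw [step, distribution_mk]
  have hset : {s | (lam : ℝ) < |stepFun δ c s|} =
      ⋃ i ∈ (Finset.univ.filter fun i : Fin L => (lam : ℝ) < |c i|),
        Set.Ico ((i : ℕ) * δ) (((i : ℕ) + 1) * δ) := by
    ext s
    simp only [Set.mem_ofPred_eq, Set.mem_iUnion, Finset.mem_filter, Finset.mem_univ, true_and,
      exists_prop, ← floor_cell hδ]
    constructor
    · intro hs
      unfold stepFun at hs
      split_ifs at hs with h
      · exact ⟨⟨_, h.2⟩, hs, h.1, rfl⟩
      · simp at hs
    · rintro ⟨i, hi, h0, h⟩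
      have h2 : ⌊s / δ⌋₊ < L := h ▸ i.2
      have h3 : (⟨⌊s / δ⌋₊, h2⟩ : Fin L) = i := Fin.ext h
      rw [stepFun, dif_pos ⟨h0, h2⟩, h3]
      exact hi
  rw [hset, measure_biUnion_finset]
  · rw [Finset.sum_filter]
    refine Finset.sum_congr rfl fun i _ => ?_
    split_ifs
    · rw [leb, Measure.restrict_apply measurableSet_Ico, Set.inter_eq_left.2, Real.volume_Ico]
      · congr 1; ring
      · intro t ht
        refine ⟨le_trans (by positivity) ht.1, lt_of_lt_of_le ?_ hL⟩
        have h2 : ((i : ℕ) : ℝ) + 1 ≤ L := by exact_mod_cast i.2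
        have h3 : t < L * δ := ht.2.trans_le (by gcongr)
        exact (ENNReal.ofReal_lt_ofReal_iff (lt_of_le_of_lt (le_trans (by positivity) ht.1) h3)).2 h3
    · rfl
  · intro i _ j _ hij
    refine Set.disjoint_left.2 fun t hi hj => hij (Fin.ext ?_)
    rw [← ((floor_cell hδ i).2 hi).2, ← ((floor_cell hδ j).2 hj).2]
  · exact fun _ _ => measurableSet_Ico

lemma equimeasurable_step_perm {δ : ℝ} (hδ : 0 < δ) {L : ℕ} (hL : ENNReal.ofReal (L * δ) ≤ α)
    (c : Fin L → ℝ) (σ : Equiv.Perm (Fin L)) :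
    Equimeasurable (step α δ fun i => c (σ i)) (step α δ c) := by
  intro lam
  rw [distribution_step hδ hL, distribution_step hδ hL]
  exact Equiv.sum_comp σ fun i => if (lam : ℝ) < |c i| then ENNReal.ofReal δ else 0

/-! ### Norm comparison for step functions -/

namespace BanachFunctionSpace

/-- `E` contains `x`, with norm at most `R`. -/
def InBall (E : BanachFunctionSpace α) (R : ℝ) (x : L0 α) : Prop :=
  ∃ h : x ∈ E.carrier, E.nrm ⟨x, h⟩ ≤ R

lemma InBall.of_le {E : BanachFunctionSpace α} {R : ℝ} {x y : L0 α} (hy : E.InBall R y)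
    (h : ∀ᵐ t ∂(leb α), |x t| ≤ |y t|) : E.InBall R x := by
  obtain ⟨hyE, hyR⟩ := hy
  obtain ⟨hxE, hx⟩ := E.ideal x ⟨y, hyE⟩ h
  exact ⟨hxE, hx.trans hyR⟩

lemma InBall.of_equimeasurable {E : BanachFunctionSpace α} (hE : E.IsSymmetric) {R : ℝ}
    {x y : L0 α} (hy : E.InBall R y) (h : Equimeasurable x y) : E.InBall R x := by
  obtain ⟨hyE, hyR⟩ := hy
  obtain ⟨hxE, hx⟩ := hE x ⟨y, hyE⟩ h
  exact ⟨hxE, hx.le.trans hyR⟩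

lemma InBall.convex (E : BanachFunctionSpace α) (R : ℝ) {x y : L0 α} (hx : E.InBall R x)
    (hy : E.InBall R y) {p q : ℝ} (hp : 0 ≤ p) (hq : 0 ≤ q) (hpq : p + q = 1) :
    E.InBall R (p • x + q • y) := by
  obtain ⟨hxE, hx⟩ := hx
  obtain ⟨hyE, hy⟩ := hy
  refine ⟨E.carrier.add_mem (E.carrier.smul_mem p hxE) (E.carrier.smul_mem q hyE), ?_⟩
  calc E.nrm (p • ⟨x, hxE⟩ + q • ⟨y, hyE⟩)
      ≤ E.nrm (p • ⟨x, hxE⟩) + E.nrm (q • ⟨y, hyE⟩) := map_add_le_add _ _ _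
    _ = p * E.nrm ⟨x, hxE⟩ + q * E.nrm ⟨y, hyE⟩ := by
        rw [map_smul_eq_mul, map_smul_eq_mul, Real.norm_of_nonneg hp, Real.norm_of_nonneg hq]
    _ ≤ p * R + q * R := by gcongr
    _ = R := by rw [← add_mul, hpq, one_mul]

/-- Monotonicity of the norm of step functions under weak majorization of the values. -/
lemma inBall_step_of_majorized {E : BanachFunctionSpace α} (hE : E.IsSymmetric) {δ : ℝ}
    (hδ : 0 < δ) {L : ℕ} (hL : ENNReal.ofReal (L * δ) ≤ α) {a b : ℕ → ℝ} {R : ℝ}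
    (ha0 : ∀ i < L, 0 ≤ a i) (ha : ∀ i j, i ≤ j → j < L → a j ≤ a i)
    (h : ∀ l ≤ L, ∑ i ∈ Finset.range l, a i ≤ ∑ i ∈ Finset.range l, b i)
    (hb : E.InBall R (step α δ fun i : Fin L => b i)) :
    E.InBall R (step α δ fun i : Fin L => a i) := by
  obtain ⟨c, hc, hac⟩ := exists_mem_convexHull_perm ha h
  have hsub : convexHull ℝ (Set.range fun σ : Equiv.Perm (Fin L) => fun i : Fin L => b (σ i)) ⊆
      {c | E.InBall R (step α δ c)} := by
    refine convexHull_min ?_ ?_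
    · rintro _ ⟨σ, rfl⟩
      exact hb.of_equimeasurable hE (equimeasurable_step_perm hδ hL (fun i : Fin L => b i) σ)
    · intro c hc d hd p q hp hq hpq
      change E.InBall R _
      rw [step_add_smul]
      exact InBall.convex E R hc hd hp hq hpq
  have hcE : E.InBall R (step α δ c) := hsub hc
  refine hcE.of_le ?_
  filter_upwards [coeFn_step (α := α) δ c, coeFn_step (α := α) δ fun i : Fin L => a i]
    with t h1 h2
  rw [h1, h2]
  unfold stepFun
  split_ifs with h
  · exact abs_le_abs_of_nonneg (ha0 _ h.2) (hac _)
  · exact le_rfl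

end BanachFunctionSpace

lemma stepFun_nat (δ : ℝ) (L : ℕ) (b : ℕ → ℝ) (t : ℝ) :
    stepFun δ (fun i : Fin L => b i) t = if 0 ≤ t ∧ ⌊t / δ⌋₊ < L then b ⌊t / δ⌋₊ else 0 := by
  unfold stepFun
  split_ifs <;> rfl

lemma floor_div_refine {h δ : ℝ} {M : ℕ} (hM : h = δ * M) (t : ℝ) :
    ⌊t / h⌋₊ = ⌊t / δ⌋₊ / M := by
  rw [hM, ← div_div, Nat.floor_div_natCast]

lemma stepFun_refine {h δ : ℝ} {M : ℕ} (hM0 : 0 < M) (hM : h = δ * M) (N : ℕ) (a : ℕ → ℝ)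
    (t : ℝ) :
    stepFun h (fun i : Fin N => a i) t = stepFun δ (fun i : Fin (N * M) => a ((i : ℕ) / M)) t := by
  rw [stepFun_nat, stepFun_nat δ (N * M) (fun i => a (i / M)), floor_div_refine hM]
  simp only [Nat.div_lt_iff_lt_mul hM0]

/-- Averages over initial segments of a decreasing sequence decrease. This handles partial sums that
stop inside the first coarse cell. -/
lemma mul_sum_le_of_antitone {b : ℕ → ℝ} (hb : Antitone b) {l M : ℕ} (hlM : l ≤ M) :
    l * ∑ i ∈ Finset.range M, b i ≤ M * ∑ i ∈ Finset.range l, b i := by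
  induction M, hlM using Nat.le_induction with
  | base => exact le_rfl
  | succ M hlM ih =>
    rw [Finset.sum_range_succ, mul_add]
    have h1 : (l : ℝ) * b M ≤ ∑ i ∈ Finset.range l, b i := by
      have := Finset.card_nsmul_le_sum (Finset.range l) b (b M) fun i hi =>
        hb ((Finset.mem_range.1 hi).le.trans hlM)
      simpa using this
    push_cast
    linarith

lemma LocInt.tendsto_rr_right {x : L0 α} (hx : LocInt x) {t : ℝ} (ht : 0 < t) :
    Tendsto (rr x) (𝓝[>] t) (𝓝 (rr x t)) := by
  rw [tendsto_order]
  constructor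
  · intro a ha
    rcases lt_or_ge a 0 with h0 | h0
    · exact Eventually.of_forall fun s => h0.trans_le (rr_nonneg x s)
    · lift a to ℝ≥0 using h0
      have h1 : (a : ℝ≥0∞) < rearr x t := by
        rwa [rr, ← ENNReal.ofReal_lt_iff_lt_toReal a.coe_nonneg (hx.rearr_lt_top ht).ne,
          ENNReal.ofReal_coe_nnreal] at ha
      obtain ⟨t', htt', h2⟩ := exists_lt_rearr_right x ht.le h1
      filter_upwards [Ioo_mem_nhdsGT htt'] with s hs
      have h3 : (a : ℝ≥0∞) < rearr x s := h2.trans_le (rearr_antitone x hs.2.le)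
      rwa [rr, ← ENNReal.ofReal_lt_iff_lt_toReal a.coe_nonneg
        (hx.rearr_lt_top (ht.trans hs.1)).ne, ENNReal.ofReal_coe_nnreal]
  · intro a ha
    filter_upwards [self_mem_nhdsWithin] with s hs
    exact (hx.rr_antitone ht (le_of_lt hs)).trans_lt ha

namespace BanachFunctionSpace

/-- Lower step functions of `x*`, slightly contracted, have norm at most that of any `y ≻ x`. -/
lemma inBall_step_of_prim_le {E : BanachFunctionSpace α} (hE : E.IsSymmetric) {x y : L0 α}
    (hx : LocInt x) (hy : LocInt y)
    (hxy : ∀ t : ℝ, 0 < t → ENNReal.ofReal t ≤ α → prim x t ≤ prim y t)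
    {h : ℝ} (hh : 0 < h) {N : ℕ} (hN : ENNReal.ofReal (N * h) ≤ α) {θ : ℝ} (hθ0 : 0 ≤ θ)
    (hθ1 : θ < 1) {R : ℝ} (hyR : E.InBall R y) :
    E.InBall R (step α h fun i : Fin N => θ * rr x (((i : ℕ) + 1) * h)) := by
  rcases Nat.eq_zero_or_pos N with rfl | hN0
  · refine hyR.of_le ?_
    filter_upwards [coeFn_step (α := α) h fun i : Fin 0 => θ * rr x (((i : ℕ) + 1) * h)] with t ht
    rw [ht, stepFun, dif_neg (by simp)]
    simp
  have hN1 : (1 : ℝ) ≤ N := by exact_mod_cast hN0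
  have hhα : ENNReal.ofReal h ≤ α :=
    (ENNReal.ofReal_le_ofReal (by nlinarith)).trans hN
  rcases (prim_nonneg y h).eq_or_lt with hzero | hpos
  · have h1 := hx.mul_rr_le le_rfl hh.le
    have h2 := hxy h hh hhα
    rw [prim_zero, sub_zero, sub_zero] at h1
    have h3 : rr x h ≤ 0 := by
      by_contra! hc
      have := mul_pos hh hc
      linarith
    refine hyR.of_le ?_
    filter_upwards [coeFn_step (α := α) h fun i : Fin N => θ * rr x (((i : ℕ) + 1) * h)] with t ht
    rw [ht, stepFun_nat h N fun i => θ * rr x ((i + 1) * h)]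
    split_ifs with hc
    · have h4 : rr x ((⌊t / h⌋₊ + 1) * h) ≤ rr x h := by
        refine hx.rr_antitone hh ?_
        have : (0 : ℝ) ≤ ⌊t / h⌋₊ := Nat.cast_nonneg _
        nlinarith
      have h5 : rr x ((⌊t / h⌋₊ + 1) * h) = 0 := le_antisymm (h4.trans h3) (rr_nonneg _ _)
      simp [h5]
    · simp
  -- Sampling y* at right endpoints loses at most the mass of the first fine cell. `M` is taken so
  -- large that the contraction by `θ` pays for this loss.
  obtain ⟨M, hM0, hMy⟩ : ∃ M : ℕ, 0 < M ∧ prim y (h / M) ≤ (1 - θ) * prim y h := by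
    have h1 : Tendsto (fun M : ℕ => h / (M : ℝ)) atTop (𝓝[>] 0) := by
      refine tendsto_nhdsWithin_iff.2 ⟨tendsto_const_div_atTop_nhds_zero_nat h, ?_⟩
      filter_upwards [eventually_gt_atTop 0] with M hM
      exact div_pos hh (by exact_mod_cast hM)
    have h2 := (hy.tendsto_prim_zero.comp h1).eventually
      (gt_mem_nhds (mul_pos (sub_pos.2 hθ1) hpos))
    obtain ⟨M, hM⟩ := (h2.and (eventually_gt_atTop 0)).exists
    exact ⟨M, hM.2, hM.1.le⟩
  set δ := h / M with hδ
  have hM0' : (0 : ℝ) < M := by exact_mod_cast hM0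
  have hδ0 : 0 < δ := div_pos hh hM0'
  have hMδ : h = δ * M := (div_mul_cancel₀ h hM0'.ne').symm
  set a : ℕ → ℝ := fun i => θ * rr x (((i / M : ℕ) + 1) * h) with ha
  set b : ℕ → ℝ := fun i => rr y ((i + 1) * δ) with hb
  have hLα : ENNReal.ofReal ((N * M : ℕ) * δ) ≤ α := by
    refine le_of_eq_of_le ?_ hN
    push_cast
    rw [hMδ]; ring_nf
  have hbanti : Antitone b := fun i j hij => hy.rr_antitone (by positivity) (by
    have : (i : ℝ) ≤ j := by exact_mod_cast hij
    gcongr)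
  have hbR : E.InBall R (step α δ fun i : Fin (N * M) => b i) := by
    refine (hyR.of_equimeasurable hE hy.equimeasurable_star).of_le ?_
    filter_upwards [coeFn_step (α := α) δ fun i : Fin (N * M) => b i,
      AEEqFun.coeFn_mk (μ := leb α) (rr y) (measurable_rr y).aestronglyMeasurable, ae_leb_pos]
      with t h1 h2 h3
    rw [h1, star, h2, stepFun_nat]
    split_ifs
    · refine abs_le_abs_of_nonneg (rr_nonneg _ _) (hy.rr_antitone h3 ?_)
      rw [← div_le_iff₀ hδ0]
      exact (Nat.lt_floor_add_one _).le
    · simp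
  have hA : ∀ l : ℕ, δ * ∑ i ∈ Finset.range l, a i ≤ θ * prim x (l * δ) := by
    intro l
    induction l with
    | zero => simp [prim_zero]
    | succ l ih =>
      rw [Finset.sum_range_succ, mul_add]
      have hle : ((l : ℝ) + 1) * δ ≤ ((l / M : ℕ) + 1) * h := by
        have h1 : l + 1 ≤ (l / M + 1) * M := by
          have := Nat.lt_div_mul_add (a := l) hM0
          rw [add_mul, one_mul]; omega
        have h2 : (l : ℝ) + 1 ≤ ((l / M : ℕ) + 1) * M := by exact_mod_cast h1
        rw [hMδ]; nlinarith
      have h1 : a l ≤ θ * rr x ((l + 1) * δ) :=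
        mul_le_mul_of_nonneg_left (hx.rr_antitone (by positivity) hle) hθ0
      have h2 := hx.mul_rr_le (s := l * δ) (t := (l + 1) * δ) (by positivity) (by nlinarith)
      have h3 := mul_le_mul_of_nonneg_left h2 hθ0
      have h4 := mul_le_mul_of_nonneg_left h1 hδ0.le
      push_cast
      nlinarith
  have hB : ∀ l : ℕ, prim y (l * δ) - prim y δ ≤ δ * ∑ i ∈ Finset.range l, b i := by
    intro l
    have : prim y ((l + 1) * δ) - prim y δ ≤ δ * ∑ i ∈ Finset.range l, b i := by
      induction l with
      | zero => simp
      | succ l ih =>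
        rw [Finset.sum_range_succ, mul_add]
        have h2 := hy.le_mul_rr (s := (l + 1) * δ) (t := (l + 1 + 1) * δ) (by positivity)
          (by nlinarith)
        push_cast
        simp only [hb] at ih ⊢
        linarith
    have h2 := hy.prim_mono (show (l : ℝ) * δ ≤ (l + 1) * δ by nlinarith)
    linarith
  -- θΦ_x ≤ Φ_y − (1−θ)Φ_y at lδ, and the subtracted term is at least (1−θ)Φ_y(h) ≥ Φ_y(δ) because
  -- lδ ≥ h.
  have hlarge : ∀ l : ℕ, M ≤ l → l ≤ N * M →
      ∑ i ∈ Finset.range l, a i ≤ ∑ i ∈ Finset.range l, b i := by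
    intro l hMl hlL
    have hl0 : (0 : ℝ) < l := by exact_mod_cast hM0.trans_le hMl
    have h1 : prim x (l * δ) ≤ prim y (l * δ) := by
      refine hxy _ (by positivity) ((ENNReal.ofReal_le_ofReal ?_).trans hLα)
      have : (l : ℝ) ≤ (N * M : ℕ) := by exact_mod_cast hlL
      gcongr
    have h2 : prim y h ≤ prim y (l * δ) := hy.prim_mono (by
      have : (M : ℝ) ≤ l := by exact_mod_cast hMl
      rw [hMδ]; nlinarith)
    have h3 := mul_le_mul_of_nonneg_left h1 hθ0
    have h4 := mul_le_mul_of_nonneg_left h2 (sub_pos.2 hθ1).le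
    refine le_of_mul_le_mul_left ?_ hδ0
    linarith [hA l, hB l]
  have hmaj : ∀ l ≤ N * M, ∑ i ∈ Finset.range l, a i ≤ ∑ i ∈ Finset.range l, b i := by
    intro l hl
    rcases le_or_gt M l with hMl | hMl
    · exact hlarge l hMl hl
    -- Below `M` the sequence `a` is constant, so the comparison at `M` passes down through averages
    -- of `b`.
    · have h1 := hlarge M le_rfl (Nat.le_mul_of_pos_left M hN0)
      have h2 := mul_sum_le_of_antitone hbanti hMl.le
      have h3 : ∀ k ≤ M, ∑ i ∈ Finset.range k, a i = k * a 0 := by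
        intro k hk
        rw [Finset.sum_congr rfl fun i hi => show a i = a 0 by
          simp only [ha]
          rw [Nat.div_eq_of_lt ((Finset.mem_range.1 hi).trans_le hk), Nat.zero_div]]
        simp
      rw [h3 M le_rfl] at h1
      rw [h3 l hMl.le]
      refine le_of_mul_le_mul_left ?_ hM0'
      have h4 := mul_le_mul_of_nonneg_left h1 (Nat.cast_nonneg (α := ℝ) l)
      linarith
  have haR := inBall_step_of_majorized hE hδ0 hLα (a := a)
    (fun i _ => mul_nonneg hθ0 (rr_nonneg _ _))
    (fun i j hij _ => mul_le_mul_of_nonneg_left (hx.rr_antitone (by positivity) (by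
      have : ((i / M : ℕ) : ℝ) ≤ (j / M : ℕ) := by exact_mod_cast Nat.div_le_div_right hij
      gcongr)) hθ0) hmaj hbR
  refine haR.of_le ?_
  filter_upwards [coeFn_step (α := α) δ fun i : Fin (N * M) => a i,
    coeFn_step (α := α) h fun i : Fin N => θ * rr x (((i : ℕ) + 1) * h)] with t h1 h2
  rw [h1, h2, stepFun_refine hM0 hMδ N fun i => θ * rr x ((i + 1) * h)]

end BanachFunctionSpace

/-! ### Monotonicity of the norm for ≺ from the Fatou property -/

lemma exists_cells (hα : α = 1 ∨ α = ∞) : ∃ N : ℕ → ℕ,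
    (∀ k, ENNReal.ofReal (N k * (1 / 2 : ℝ) ^ k) ≤ α) ∧ (∀ k, N k * 2 ≤ N (k + 1)) ∧
      ∀ t ∈ I α, ∀ᶠ k in atTop, t < N k * (1 / 2 : ℝ) ^ k := by
  rcases hα with rfl | rfl
  · refine ⟨fun k => 2 ^ k, fun k => ?_, fun k => (pow_succ 2 k).ge, fun t ht => ?_⟩
    · simp
    · refine Eventually.of_forall fun k => ?_
      have : t < 1 := by simpa using ht.2
      simpa using this
  -- With 4^k cells of length 2^-k, the grid refines while covering [0, 2^k).
  · refine ⟨fun k => 4 ^ k, fun k => le_top, fun k => ?_, fun t _ => ?_⟩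
    · simp only [pow_succ]; omega
    · have h := (tendsto_pow_atTop_atTop_of_one_lt (one_lt_two : (1 : ℝ) < 2)).eventually
        (eventually_gt_atTop t)
      filter_upwards [h] with k hk
      push_cast
      rw [← mul_pow]
      norm_num
      exact hk

namespace BanachFunctionSpace

/-- A symmetric space with the Fatou property is fully symmetric (`K`-monotone). -/
theorem inBall_of_prim_le (hα : α = 1 ∨ α = ∞) {E : BanachFunctionSpace α} (hE : E.IsSymmetric)
    (hF : E.HasFatouProperty) {x y : L0 α} (hx : LocInt x) (hy : LocInt y)
    (hxy : ∀ t : ℝ, 0 < t → ENNReal.ofReal t ≤ α → prim x t ≤ prim y t)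
    {R : ℝ} (hyR : E.InBall R y) : E.InBall R x := by
  obtain ⟨N, hNα, hNmono, hNt⟩ := exists_cells hα
  set h : ℕ → ℝ := fun k => (1 / 2 : ℝ) ^ k with hh
  have hpos : ∀ k, 0 < h k := fun k => by positivity
  -- Each contraction is strict, as the step-function comparison requires, yet they increase to 1,
  -- as the Fatou property requires.
  set θ : ℕ → ℝ := fun k => 1 - (1 / 2 : ℝ) ^ k with hθ
  have hθ0 : ∀ k, 0 ≤ θ k := fun k => sub_nonneg.2 (pow_le_one₀ (by norm_num) (by norm_num))
  have hθ1 : ∀ k, θ k < 1 := fun k => sub_lt_self _ (hpos k)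
  set w : ℕ → L0 α := fun k => step α (h k) fun i : Fin (N k) => θ k * rr x (((i : ℕ) + 1) * h k)
    with hw
  have hwR : ∀ k, E.InBall R (w k) := fun k =>
    inBall_step_of_prim_le hE hx hy hxy (hpos k) (hNα k) (hθ0 k) (hθ1 k) hyR
  choose hwE hwnrm using hwR
  have hval : ∀ k, ∀ᵐ t ∂(leb α), w k t = if 0 ≤ t ∧ ⌊t / h k⌋₊ < N k then
      θ k * rr x ((⌊t / h k⌋₊ + 1) * h k) else 0 := by
    intro k
    filter_upwards [coeFn_step (α := α) (h k)
      fun i : Fin (N k) => θ k * rr x (((i : ℕ) + 1) * h k)] with t ht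
    rw [hw, ht, stepFun_nat (h k) (N k) fun i => θ k * rr x ((i + 1) * h k)]
  have hstar : E.InBall R (star x) := by
    have hlim : ∃ hE' : star x ∈ E.carrier,
        Tendsto (fun k => E.nrm ⟨w k, hwE k⟩) atTop (𝓝 (E.nrm ⟨star x, hE'⟩)) := by
      refine hF (fun k => ⟨w k, hwE k⟩) (star x) ?_ ?_ ?_ ?_
      · intro k
        filter_upwards [hval k] with t ht
        rw [ht]
        split_ifs
        · exact mul_nonneg (hθ0 k) (rr_nonneg _ _)
        · exact le_rfl
      · intro k
        filter_upwards [hval k, hval (k + 1)] with t ht ht'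
        rw [ht, ht']
        have hhalf : h k = h (k + 1) * (2 : ℕ) := by simp only [hh, pow_succ]; push_cast; ring
        rw [floor_div_refine hhalf t]
        set j := ⌊t / h (k + 1)⌋₊
        by_cases hc : 0 ≤ t ∧ j / 2 < N k
        · have hk := hNmono k
          rw [if_pos hc, if_pos ⟨hc.1, by omega⟩]
          -- Halving the cells can only move the sampling point to the left, so the sampled value of
          -- x* does not decrease.
          have hle : ((j : ℝ) + 1) * h (k + 1) ≤ ((j / 2 : ℕ) + 1) * h k := by
            have h1 : j + 1 ≤ (j / 2 + 1) * 2 := by omega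
            have h2 : (j : ℝ) + 1 ≤ ((j / 2 : ℕ) + 1) * 2 := by exact_mod_cast h1
            rw [hhalf]; push_cast; nlinarith [hpos (k + 1)]
          have hθle : θ k ≤ θ (k + 1) := by
            have h3 := hpos (k + 1)
            simp only [hh] at hhalf h3
            simp only [hθ]
            push_cast at hhalf
            linarith
          exact mul_le_mul hθle (hx.rr_antitone (mul_pos (by positivity) (hpos _)) hle)
            (rr_nonneg _ _) (hθ0 _)
        · rw [if_neg hc]
          split_ifs
          · exact mul_nonneg (hθ0 _) (rr_nonneg _ _)
          · exact le_rfl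
      · filter_upwards [ae_all_iff.2 hval, ae_leb_pos, ae_leb_mem,
          AEEqFun.coeFn_mk (μ := leb α) (rr x) (measurable_rr x).aestronglyMeasurable]
          with t ht ht0 htI hst
        rw [star, hst]
        have hhlim : Tendsto h atTop (𝓝 0) :=
          tendsto_pow_atTop_nhds_zero_of_lt_one (by norm_num) (by norm_num)
        -- The sampling points approach `t` strictly from the right, so right continuity of x*
        -- suffices.
        have hτ : Tendsto (fun k => ((⌊t / h k⌋₊ : ℝ) + 1) * h k) atTop (𝓝[>] t) := by
          refine tendsto_nhdsWithin_iff.2 ⟨?_, Eventually.of_forall fun k => ?_⟩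
          · refine tendsto_of_tendsto_of_tendsto_of_le_of_le tendsto_const_nhds
              (h := fun k => t + h k) ?_ (fun k => ?_) (fun k => ?_)
            · simpa using tendsto_const_nhds.add hhlim
            · exact ((div_lt_iff₀ (hpos k)).1 (Nat.lt_floor_add_one (t / h k))).le
            · have h1 := Nat.floor_le (div_nonneg ht0.le (hpos k).le)
              rw [le_div_iff₀ (hpos k)] at h1
              change _ ≤ t + h k
              linarith
          · exact (div_lt_iff₀ (hpos k)).1 (Nat.lt_floor_add_one (t / h k))
        have hθlim : Tendsto θ atTop (𝓝 1) := by
          simpa using (tendsto_const_nhds (x := (1 : ℝ))).sub hhlim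
        have hlim := hθlim.mul ((hx.tendsto_rr_right ht0).comp hτ)
        rw [one_mul] at hlim
        refine hlim.congr' ?_
        filter_upwards [hNt t htI] with k hk
        rw [ht k, if_pos]
        · rfl
        · refine ⟨ht0.le, (Nat.floor_lt (div_nonneg ht0.le (hpos k).le)).2 ?_⟩
          rwa [div_lt_iff₀ (hpos k)]
      · exact ⟨R, by rintro _ ⟨k, rfl⟩; exact hwnrm k⟩
    obtain ⟨hE', hT⟩ := hlim
    exact ⟨hE', le_of_tendsto' hT hwnrm⟩
  exact hstar.of_equimeasurable hE fun lam => (hx.equimeasurable_star lam).symm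

end BanachFunctionSpace

/-! ### Local integrability at an LKM point -/

lemma exists_distribution_lt_top (hα : α = 1 ∨ α = ∞) {x : L0 α}
    (hx0 : RearrVanishesAtInfinity x) : ∃ lam : ℝ≥0, distribution x lam < ∞ := by
  rcases hα with rfl | hα
  · exact ⟨0, (distribution_le x 0).trans_lt ENNReal.one_lt_top⟩
  · obtain ⟨t, ht⟩ := ((hx0 hα).eventually (gt_mem_nhds zero_lt_one)).exists
    exact ⟨1, ((rearr_le_iff x 1 t).1 (by exact_mod_cast ht.le)).trans_lt ENNReal.ofReal_lt_top⟩

/-- Since `x` is real-valued, its superlevel sets shrink to ∅; one level of finite measure gives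
continuity from above. -/
lemma rearr_lt_top_of_distribution_lt_top {x : L0 α} {lam : ℝ≥0} (h : distribution x lam < ∞)
    {t : ℝ} (ht : 0 < t) : rearr x t < ∞ := by
  have hmeas : Measurable x := (AEEqFun.stronglyMeasurable x).measurable
  have hlim : Tendsto (fun n : ℕ => leb α {s | ((lam + n : ℝ≥0) : ℝ) < |x s|}) atTop
      (𝓝 (leb α (⋂ n : ℕ, {s | ((lam + n : ℝ≥0) : ℝ) < |x s|}))) := by
    refine tendsto_measure_iInter_atTop ?_ ?_ ⟨0, ?_⟩
    · intro n
      exact (measurableSet_lt measurable_const hmeas.abs).nullMeasurableSet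
    · intro m n hmn s hs
      have hs' : ((lam + n : ℝ≥0) : ℝ) < |x s| := hs
      refine lt_of_le_of_lt ?_ hs'
      push_cast
      have : (m : ℝ) ≤ n := by exact_mod_cast hmn
      linarith
    · simpa [distribution] using h.ne
  have hempty : (⋂ n : ℕ, {s | ((lam + n : ℝ≥0) : ℝ) < |x s|}) = ∅ := by
    refine Set.eq_empty_of_forall_notMem fun s hs => ?_
    obtain ⟨n, hn⟩ := exists_nat_gt |x s|
    have h1 : ((lam + n : ℝ≥0) : ℝ) < |x s| := Set.mem_iInter.1 hs n
    push_cast at h1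
    have := lam.coe_nonneg
    linarith
  rw [hempty, measure_empty] at hlim
  obtain ⟨n, hn⟩ := (hlim.eventually (gt_mem_nhds (ENNReal.ofReal_pos.2 ht))).exists
  exact ((rearr_le_iff x (lam + n) t).2 hn.le).trans_lt ENNReal.coe_lt_top

lemma distribution_two_smul (x : L0 α) (lam : ℝ≥0) :
    distribution ((2 : ℝ) • x) (2 * lam) = distribution x lam := by
  refine measure_congr ?_
  filter_upwards [AEEqFun.coeFn_smul (2 : ℝ) x] with s hs
  refine propext ?_
  change ((2 * lam : ℝ≥0) : ℝ) < |((2 : ℝ) • x : L0 α) s| ↔ (lam : ℝ) < |x s|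
  rw [hs, Pi.smul_apply, smul_eq_mul, abs_mul, abs_two]
  push_cast
  constructor <;> intro <;> linarith

lemma rearr_eq_zero_of_rearr_two_smul {x : L0 α} (h : rearr x = rearr ((2 : ℝ) • x)) {t : ℝ}
    (ht : rearr x t < ∞) : rearr x t = 0 := by
  by_contra hne
  obtain ⟨a, ha⟩ : ∃ a : ℝ≥0, (a : ℝ≥0∞) = rearr x t := ⟨_, ENNReal.coe_toNNReal ht.ne⟩
  have ha0 : 0 < a := by
    rw [pos_iff_ne_zero]
    rintro rfl
    exact hne (by simp [← ha])
  have h1 : ((a / 2 : ℝ≥0) : ℝ≥0∞) < rearr x t := by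
    rw [← ha]; exact_mod_cast NNReal.half_lt_self ha0.ne'
  rw [lt_rearr_iff, ← distribution_two_smul, mul_div_cancel₀ a two_ne_zero, ← lt_rearr_iff, ← h,
    ← ha] at h1
  exact lt_irrefl _ h1

/-- The rearrangement of an `LKM` point vanishing at infinity is locally integrable. -/
theorem BanachFunctionSpace.IsLKMPoint.locInt (hα : α = 1 ∨ α = ∞) {E : BanachFunctionSpace α}
    {x : E.carrier} (hx : E.IsLKMPoint x) (hx0 : RearrVanishesAtInfinity (x : L0 α)) :
    LocInt (x : L0 α) := by
  by_contra hcon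
  simp only [LocInt, not_forall, not_lt, top_le_iff] at hcon
  obtain ⟨t₁, ht₁⟩ := hcon
  obtain ⟨lam, hlam⟩ := exists_distribution_lt_top hα hx0
  have hfin : ∀ t : ℝ, 0 < t → rearr (x : L0 α) t < ∞ := fun t ht =>
    rearr_lt_top_of_distribution_lt_top hlam ht
  -- x* is finite away from 0, so a divergent integral must diverge at 0, hence over every (0, t).
  have htop : ∀ t : ℝ, 0 < t → rearrInt (x : L0 α) t = ∞ := by
    intro t ht
    by_contra hne
    have h1 := rearrInt_add (x : L0 α) ht.le (le_max_left t t₁)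
    have h2 : rearrInt (x : L0 α) (max t t₁) = ∞ :=
      top_le_iff.1 (ht₁ ▸ rearrInt_mono (x : L0 α) (le_max_right t t₁))
    have h3 : ∫⁻ r in Set.Ioo t (max t t₁), rearr (x : L0 α) r < ∞ :=
      (le_mul_rearr (x : L0 α)).trans_lt (ENNReal.mul_lt_top ENNReal.ofReal_lt_top (hfin t ht))
    rw [h2] at h1
    exact (ENNReal.add_lt_top.2 ⟨lt_top_iff_ne_top.2 hne, h3⟩).ne h1.symm
  have hne : rearr (x : L0 α) ≠ rearr (((2 : ℝ) • x : E.carrier) : L0 α) := by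
    intro heq
    have h0 : rearrInt (x : L0 α) t₁ = 0 := by
      rw [rearrInt, setLIntegral_congr_fun measurableSet_Ioo
        (fun s hs => rearr_eq_zero_of_rearr_two_smul heq (hfin s hs.1)), lintegral_zero]
    rw [h0] at ht₁
    exact ENNReal.zero_ne_top ht₁
  -- Everything is now ≺ x, including 2x, and the LKM property would give 2‖x‖ < ‖x‖.
  have hlt := hx ((2 : ℝ) • x) hne (hlp_iff.2 fun t ht => by rw [htop t ht]; exact le_top)
  rw [map_smul_eq_mul, Real.norm_of_nonneg zero_le_two] at hlt
  have := apply_nonneg E.nrm x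
  linarith

/-! ### Realizing a truncated concave primitive -/

lemma hlp_of_le (hα : α = 1 ∨ α = ∞) {x y : L0 α}
    (h : ∀ t : ℝ, 0 < t → ENNReal.ofReal t ≤ α → rearrInt x t ≤ rearrInt y t) : HLP x y := by
  refine hlp_iff.2 fun t ht => ?_
  rcases le_or_gt (ENNReal.ofReal t) α with hle | hlt
  · exact h t ht hle
  · rcases hα with rfl | rfl
    · have h1 : 1 ≤ t := by simpa using hlt.le
      have hzero : ∫⁻ r in Set.Ioo 1 t, rearr x r = 0 := by
        rw [setLIntegral_congr_fun measurableSet_Ioo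
          (fun s hs => rearr_eq_zero_of_le x (by simpa using hs.1.le)), lintegral_zero]
      rw [rearrInt_add x zero_le_one h1, hzero, add_zero]
      exact (h 1 one_pos (by simp)).trans (rearrInt_mono y h1)
    · exact absurd hlt (not_lt.2 le_top)

/-- Two primitives of the same decreasing function have the same increments. -/
lemma sub_eq_sub_of_slopes {f F G : ℝ → ℝ} {s t : ℝ} (hst : s ≤ t)
    (hF1 : ∀ a b, s ≤ a → a ≤ b → b ≤ t → (b - a) * f b ≤ F b - F a)
    (hF2 : ∀ a b, s ≤ a → a ≤ b → b ≤ t → F b - F a ≤ (b - a) * f a)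
    (hG1 : ∀ a b, s ≤ a → a ≤ b → b ≤ t → (b - a) * f b ≤ G b - G a)
    (hG2 : ∀ a b, s ≤ a → a ≤ b → b ≤ t → G b - G a ≤ (b - a) * f a) :
    F t - F s = G t - G s := by
  -- Both increments lie between the lower and upper Riemann sums of `f` on `n` equal cells, whose
  -- gap telescopes.
  have key : ∀ n : ℕ, 0 < n → |(F t - F s) - (G t - G s)| ≤ (t - s) * (f s - f t) / n := by
    intro n hn
    have hn' : (0 : ℝ) < n := by exact_mod_cast hn
    set h := (t - s) / n with hh
    have hh0 : 0 ≤ h := div_nonneg (sub_nonneg.2 hst) hn'.le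
    have hnh : n * h = t - s := mul_div_cancel₀ _ hn'.ne'
    have step : ∀ i : ℕ, i ≤ n → |(F (s + i * h) - F s) - (G (s + i * h) - G s)| ≤
        h * (f s - f (s + i * h)) := by
      intro i
      induction i with
      | zero => intro _; simp
      | succ i ih =>
        intro hi
        have ih' := ih (by omega)
        have h1 : s ≤ s + i * h := le_add_of_nonneg_right (by positivity)
        have h2 : s + i * h ≤ s + ((i + 1 : ℕ) : ℝ) * h := by push_cast; linarith
        have h3 : s + ((i + 1 : ℕ) : ℝ) * h ≤ t := by
          have : ((i + 1 : ℕ) : ℝ) ≤ n := by exact_mod_cast hi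
          have := mul_le_mul_of_nonneg_right this hh0
          linarith
        have h4 : (s + ((i + 1 : ℕ) : ℝ) * h) - (s + i * h) = h := by push_cast; ring
        have a1 := hF1 _ _ h1 h2 h3
        have a2 := hF2 _ _ h1 h2 h3
        have a3 := hG1 _ _ h1 h2 h3
        have a4 := hG2 _ _ h1 h2 h3
        rw [h4] at a1 a2 a3 a4
        rw [abs_le] at ih' ⊢
        constructor <;> linarith [ih'.1, ih'.2]
    have h5 := step n le_rfl
    rw [hnh, add_sub_cancel] at h5
    rwa [hh, div_mul_eq_mul_div] at h5
  have hlim := tendsto_const_div_atTop_nhds_zero_nat ((t - s) * (f s - f t))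
  have h0 : |(F t - F s) - (G t - G s)| ≤ 0 := by
    refine ge_of_tendsto hlim ?_
    filter_upwards [eventually_gt_atTop 0] with n hn using key n hn
  exact sub_eq_zero.1 (abs_nonpos_iff.1 h0)

lemma rearr_mk_le {z : ℝ → ℝ} (hz : AEStronglyMeasurable z (leb α)) (hz0 : ∀ t, 0 ≤ z t)
    (hanti : AntitoneOn z (Set.Ioi 0)) {t : ℝ} (ht : 0 < t) :
    rearr (AEEqFun.mk z hz) t ≤ ENNReal.ofReal (z t) := by
  refine (rearr_le_iff _ (z t).toNNReal t).2 ?_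
  rw [distribution_mk]
  calc _ ≤ leb α (Set.Ioo 0 t) := by
        refine measure_mono_ae ?_
        filter_upwards [ae_leb_pos] with r hr hlt
        refine ⟨hr, ?_⟩
        by_contra! hc
        have hlt' : ((z t).toNNReal : ℝ) < |z r| := hlt
        rw [abs_of_nonneg (hz0 r), Real.coe_toNNReal _ (hz0 t)] at hlt'
        exact absurd (hanti ht hr hc) (not_le.2 hlt')
    _ ≤ volume (Set.Ioo 0 t) := Measure.restrict_apply_le _ _
    _ = ENNReal.ofReal t := by rw [Real.volume_Ioo, sub_zero]

/-- The shift from `t` to `s < t` is needed because `z` need not be right continuous. -/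
lemma le_rearr_mk {z : ℝ → ℝ} (hz : AEStronglyMeasurable z (leb α)) (hz0 : ∀ t, 0 ≤ z t)
    (hanti : AntitoneOn z (Set.Ioi 0)) {s t : ℝ} (ht : 0 < t) (hst : s < t)
    (htα : ENNReal.ofReal t ≤ α) : ENNReal.ofReal (z t) ≤ rearr (AEEqFun.mk z hz) s := by
  refine ENNReal.le_of_forall_nnreal_lt fun lam hlam => ((lt_rearr_iff _ lam s).2 ?_).le
  rw [distribution_mk]
  have hlam' : (lam : ℝ) < z t := by
    rwa [← ENNReal.ofReal_coe_nnreal, ENNReal.ofReal_lt_ofReal_iff_of_nonneg lam.coe_nonneg]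
      at hlam
  calc ENNReal.ofReal s < ENNReal.ofReal t := (ENNReal.ofReal_lt_ofReal_iff ht).2 hst
    _ = leb α (Set.Ioo 0 t) := by
        rw [leb, Measure.restrict_apply measurableSet_Ioo, Set.inter_eq_left.2, Real.volume_Ioo,
          sub_zero]
        exact fun r hr => ⟨hr.1.le, ((ENNReal.ofReal_lt_ofReal_iff ht).2 hr.2).trans_le htα⟩
    _ ≤ _ := measure_mono fun r hr => by
        change (lam : ℝ) < |z r|
        rw [abs_of_nonneg (hz0 r)]
        exact hlam'.trans_le (hanti hr.1 ht hr.2.le)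

/-- The minimum of the primitive of `x*` with an affine function is the primitive of a
rearrangement. -/
theorem exists_prim_eq_min {x : L0 α} (hx : LocInt x) {l m : ℝ} (hl : 0 ≤ l) (hm : 0 ≤ m) :
    ∃ y : L0 α, LocInt y ∧ ∀ t : ℝ, 0 < t → ENNReal.ofReal t ≤ α →
      prim y t = min (prim x t) (l + m * t) := by
  classical
  -- The slope of the minimum: `m` where the line is lower, x* elsewhere. The slope bounds order the
  -- two values across a crossing, so `z` is decreasing.
  set z : ℝ → ℝ := fun t => if l + m * t < prim x t then m else rr x t with hz
  have hzm : Measurable z := by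
    refine Measurable.ite (measurableSet_lt (by fun_prop) hx.prim_mono.measurable)
      measurable_const (measurable_rr x)
  have hz0 : ∀ t, 0 ≤ z t := fun t => by
    simp only [hz]; split_ifs
    exacts [hm, rr_nonneg x t]
  have hanti : AntitoneOn z (Set.Ioi 0) := by
    intro s hs t ht hst
    have hs' : 0 < s := hs
    rcases hst.eq_or_lt with rfl | hlt
    · exact le_rfl
    have h1 := hx.mul_rr_le hs'.le hst
    have h2 := hx.le_mul_rr hs' hst
    have h3 : 0 < t - s := sub_pos.2 hlt
    simp only [hz]
    split_ifs with ha hb hb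
    · exact le_rfl
    · refine le_of_mul_le_mul_left ?_ h3
      rw [not_lt] at hb
      linarith
    · refine le_of_mul_le_mul_left ?_ h3
      rw [not_lt] at ha
      linarith
    · exact hx.rr_antitone hs' hst
  set H : ℝ → ℝ := fun t => min (prim x t) (l + m * t) with hH
  have hH1 : ∀ s t, 0 < s → s ≤ t → (t - s) * z t ≤ H t - H s := by
    intro s t hs hst
    have h1 := hx.mul_rr_le hs.le hst
    have h2 : H s ≤ prim x s := min_le_left _ _
    have h3 : H s ≤ l + m * s := min_le_right _ _
    simp only [hz]
    split_ifs with ha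
    · have : H t = l + m * t := min_eq_right ha.le
      rw [this]; linarith
    · have : H t = prim x t := min_eq_left (not_lt.1 ha)
      rw [this]; linarith
  have hH2 : ∀ s t, 0 < s → s ≤ t → H t - H s ≤ (t - s) * z s := by
    intro s t hs hst
    have h1 := hx.le_mul_rr hs hst
    have h2 : H t ≤ prim x t := min_le_left _ _
    have h3 : H t ≤ l + m * t := min_le_right _ _
    simp only [hz]
    split_ifs with ha
    · have : H s = l + m * s := min_eq_right ha.le
      rw [this]; linarith
    · have : H s = prim x s := min_eq_left (not_lt.1 ha)
      rw [this]; linarith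
  set y : L0 α := AEEqFun.mk z hzm.aestronglyMeasurable with hy
  have hup : ∀ t, 0 < t → rearr y t ≤ ENNReal.ofReal (z t) := fun t ht =>
    rearr_mk_le _ hz0 hanti ht
  have hyL : LocInt y := by
    intro t
    calc rearrInt y t ≤ ∫⁻ s in Set.Ioo 0 t, (rearr x s + ENNReal.ofReal m) := by
          refine setLIntegral_mono' measurableSet_Ioo fun s hs => (hup s hs.1).trans ?_
          rw [← hx.ofReal_rr hs.1, ← ENNReal.ofReal_add (rr_nonneg x s) hm]
          refine ENNReal.ofReal_le_ofReal ?_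
          simp only [hz]
          have := rr_nonneg x s
          split_ifs <;> linarith
      _ < ∞ := by
          rw [lintegral_add_right _ measurable_const, setLIntegral_const]
          exact ENNReal.add_lt_top.2 ⟨hx t, ENNReal.mul_lt_top ENNReal.ofReal_lt_top (by simp)⟩
  refine ⟨y, hyL, fun t ht htα => ?_⟩
  have hrr_le : ∀ s, 0 < s → rr y s ≤ z s := fun s hs =>
    ENNReal.toReal_le_of_le_ofReal (hz0 s) (hup s hs)
  have hle_rr : ∀ s r, 0 < s → s < r → r ≤ t → z r ≤ rr y s := by
    intro s r hs hsr hrt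
    refine (ENNReal.ofReal_le_iff_le_toReal (hyL.rearr_lt_top hs).ne).1 ?_
    exact le_rearr_mk _ hz0 hanti (hs.trans hsr) hsr ((ENNReal.ofReal_le_ofReal hrt).trans htα)
  have hH1' : ∀ a b, 0 < a → a ≤ b → (b - a) * rr y b ≤ H b - H a := fun a b ha hab =>
    (mul_le_mul_of_nonneg_left (hrr_le b (ha.trans_le hab)) (sub_nonneg.2 hab)).trans
      (hH1 a b ha hab)
  have hH2' : ∀ a b, 0 < a → a ≤ b → b ≤ t → H b - H a ≤ (b - a) * rr y a := by
    intro a b ha hab hbt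
    rcases hab.eq_or_lt with rfl | hlt
    · simp
    -- `rr y a` is only known to dominate `z` strictly to the right of `a`; split at `r` and let `r`
    -- decrease to `a`.
    have hlim : Tendsto (fun r => (b - r) * rr y a + (r - a) * z a) (𝓝[>] a)
        (𝓝 ((b - a) * rr y a + (a - a) * z a)) := by
      refine Tendsto.mono_left (Continuous.tendsto ?_ a) nhdsWithin_le_nhds
      fun_prop
    rw [sub_self, zero_mul, add_zero] at hlim
    refine ge_of_tendsto hlim ?_
    filter_upwards [Ioo_mem_nhdsGT hlt] with r hr
    have h1 := hH2 r b (ha.trans hr.1) hr.2.le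
    have h2 := hH2 a r ha hr.1.le
    have h3 := mul_le_mul_of_nonneg_left (hle_rr a r ha hr.1 (hr.2.le.trans hbt))
      (sub_nonneg.2 hr.2.le)
    linarith
  have hinc : ∀ s, 0 < s → s ≤ t → prim y t - prim y s = H t - H s := fun s hs hst =>
    sub_eq_sub_of_slopes (f := rr y) hst
      (fun a b ha hab _ => hyL.mul_rr_le (hs.le.trans ha) hab)
      (fun a b ha hab _ => hyL.le_mul_rr (hs.trans_le ha) hab)
      (fun a b ha hab _ => hH1' a b (hs.trans_le ha) hab)
      (fun a b ha hab hb => hH2' a b (hs.trans_le ha) hab hb)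
  have hHlim : Tendsto H (𝓝[>] 0) (𝓝 0) := by
    refine tendsto_of_tendsto_of_tendsto_of_le_of_le' tendsto_const_nhds hx.tendsto_prim_zero ?_ ?_
    · filter_upwards [self_mem_nhdsWithin] with s hs
      have hs' : 0 < s := hs
      exact le_min (prim_nonneg x s) (by positivity)
    · exact Eventually.of_forall fun s => min_le_left _ _
  have hl1 : Tendsto (fun s => prim y t - prim y s) (𝓝[>] 0) (𝓝 (prim y t - 0)) :=
    tendsto_const_nhds.sub hyL.tendsto_prim_zero
  have hl2 : Tendsto (fun s => H t - H s) (𝓝[>] 0) (𝓝 (H t - 0)) :=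
    tendsto_const_nhds.sub hHlim
  have hl3 := hl1.congr' (f₂ := fun s => H t - H s) (by
    filter_upwards [Ioc_mem_nhdsGT ht] with s hs using hinc s hs.1 hs.2)
  simpa using tendsto_nhds_unique hl3 hl2

/-! ### Convergence of primitives at an LKM point -/

/-- Pointwise convergence of the primitives at an `LKM` point. -/
theorem tendsto_prim (hα : α = 1 ∨ α = ∞) {E : BanachFunctionSpace α} (hE : E.IsSymmetric)
    (hF : E.HasFatouProperty) {x : E.carrier} (hx : E.IsLKMPoint x) (hxL : LocInt (x : L0 α))
    {u : ℕ → E.carrier} (hu : ∀ n, HLP (u n : L0 α) (x : L0 α))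
    (hnorm : Tendsto (fun n => E.nrm (u n)) atTop (𝓝 (E.nrm x)))
    {t₀ : ℝ} (ht₀ : 0 < t₀) (htα : ENNReal.ofReal t₀ ≤ α) :
    Tendsto (fun n => prim (u n : L0 α) t₀) atTop (𝓝 (prim (x : L0 α) t₀)) := by
  have huL : ∀ n, LocInt (u n : L0 α) := fun n => hxL.of_hlp (hu n)
  have hle : ∀ n, prim (u n : L0 α) t₀ ≤ prim (x : L0 α) t₀ := fun n => hxL.prim_le (hu n) ht₀
  rw [Metric.tendsto_nhds]
  by_contra! hcon
  obtain ⟨ε, hε, hfr⟩ := hcon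
  set X : ℝ := prim (x : L0 α) t₀ with hX
  set v : ℕ → ℝ × ℝ := fun n => (prim (u n : L0 α) t₀, rr (u n : L0 α) t₀) with hv
  have hfreq : ∃ᶠ n in atTop, v n ∈ Set.Icc (0 : ℝ) (X - ε) ×ˢ Set.Icc (0 : ℝ) (X / t₀) := by
    refine hfr.mono fun n hn => ⟨⟨prim_nonneg _ _, ?_⟩, rr_nonneg _ _, ?_⟩
    · rw [Real.dist_eq, abs_sub_comm, abs_of_nonneg (sub_nonneg.2 (hle n))] at hn
      change prim (u n : L0 α) t₀ ≤ X - ε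
      linarith
    · rw [le_div_iff₀ ht₀]
      have h1 := (huL n).mul_rr_le le_rfl ht₀.le
      rw [prim_zero, sub_zero, sub_zero, mul_comm] at h1
      exact h1.trans (hle n)
  obtain ⟨⟨c, s⟩, ⟨hc, hs⟩, hclus⟩ :=
    (isCompact_Icc.prod isCompact_Icc).exists_mapClusterPt_of_frequently hfreq
  have hc2 : c ≤ X - ε := hc.2
  have hs1 : 0 ≤ s := hs.1
  -- Left of t₀ the slope error costs at most 2κt₀ = ε/4. With ε/4 for the value, the line has
  -- height c + ε/2 ≤ X − ε/2 at t₀.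
  set κ : ℝ := ε / (8 * t₀) with hκ
  have hκ0 : 0 < κ := by positivity
  have hκt : κ * t₀ = ε / 8 := by rw [hκ]; field_simp
  have hnhds : Set.Iio (c + ε / 4) ×ˢ Set.Ioo (s - κ) (s + κ) ∈ 𝓝 (c, s) :=
    prod_mem_nhds (Iio_mem_nhds (by linarith)) (Ioo_mem_nhds (by linarith) (by linarith))
  have hfreq2 := hclus.frequently hnhds
  -- the graph of each such primitive lies below a fixed line
  have hline : ∀ n, v n ∈ Set.Iio (c + ε / 4) ×ˢ Set.Ioo (s - κ) (s + κ) → ∀ t, 0 ≤ t →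
      prim (u n : L0 α) t ≤ (c + ε / 2 - (s + κ) * t₀) + (s + κ) * t := by
    rintro n ⟨h1, h2, h3⟩ t ht
    change prim (u n : L0 α) t₀ < c + ε / 4 at h1
    change s - κ < rr (u n : L0 α) t₀ at h2
    change rr (u n : L0 α) t₀ < s + κ at h3
    rcases le_or_gt t₀ t with h | h
    · have h4 := (huL n).le_mul_rr ht₀ h
      have h5 := mul_le_mul_of_nonneg_left h3.le (sub_nonneg.2 h)
      linarith
    · have h4 := (huL n).mul_rr_le ht h.le
      have h5 := mul_le_mul_of_nonneg_left h2.le (sub_nonneg.2 h.le)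
      have h6 := mul_nonneg hκ0.le ht
      linarith
  -- The line lies above a primitive that vanishes at 0, so its intercept is nonnegative.
  have hl : 0 ≤ c + ε / 2 - (s + κ) * t₀ := by
    obtain ⟨n, hn⟩ := hfreq2.exists
    have := hline n hn 0 le_rfl
    rw [prim_zero] at this
    linarith
  obtain ⟨y, hyL, hy⟩ := exists_prim_eq_min hxL hl (add_nonneg hs1 hκ0.le)
  have hyx : HLP y (x : L0 α) := by
    refine hlp_of_le hα fun t ht htα => ?_
    rw [← hyL.ofReal_prim, ← hxL.ofReal_prim, hy t ht htα]
    exact ENNReal.ofReal_le_ofReal (min_le_left _ _)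
  obtain ⟨hyE, -⟩ := BanachFunctionSpace.inBall_of_prim_le hα hE hF hyL hxL
    (fun t ht _ => hxL.prim_le hyx ht) (R := E.nrm x) ⟨x.2, le_rfl⟩
  have hne : rearr (x : L0 α) ≠ rearr y := by
    intro heq
    have h1 : prim (x : L0 α) t₀ = prim y t₀ := by simp only [prim, rearrInt, heq]
    have h2 := hy t₀ ht₀ htα
    have h3 := min_le_right (prim (x : L0 α) t₀) ((c + ε / 2 - (s + κ) * t₀) + (s + κ) * t₀)
    linarith
  have hlt : E.nrm ⟨y, hyE⟩ < E.nrm x := hx ⟨y, hyE⟩ hne hyx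
  obtain ⟨n, hn, hn'⟩ := (hfreq2.and_eventually (hnorm.eventually (lt_mem_nhds hlt))).exists
  obtain ⟨_, hun⟩ := BanachFunctionSpace.inBall_of_prim_le hα hE hF (huL n) hyL
    (fun t ht htα => by
      rw [hy t ht htα]
      exact le_min (hxL.prim_le (hu n) ht) (hline n hn t ht.le))
    (R := E.nrm ⟨y, hyE⟩) ⟨hyE, le_rfl⟩
  exact absurd hun (not_le.2 hn')

/-! ### From primitives to convergence in measure -/

/-- Convergence of primitives implies convergence of the rearrangements at continuity points. -/
lemma tendsto_rr_of_tendsto_prim {x : L0 α} (hx : LocInt x) {u : ℕ → L0 α}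
    (hu : ∀ n, LocInt (u n))
    (h : ∀ t : ℝ, 0 < t → ENNReal.ofReal t ≤ α →
      Tendsto (fun n => prim (u n) t) atTop (𝓝 (prim x t)))
    {t : ℝ} (ht : 0 < t) (htα : ENNReal.ofReal t < α) (hcont : ContinuousAt (rr x) t) :
    Tendsto (fun n => rr (u n) t) atTop (𝓝 (rr x t)) := by
  rw [tendsto_order]
  constructor
  · intro a ha
    have h1 : ∀ᶠ r in 𝓝[>] t, a < rr x r ∧ ENNReal.ofReal r < α := by
      refine (((hcont.eventually (lt_mem_nhds ha)).and ?_).filter_mono nhdsWithin_le_nhds)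
      exact ENNReal.continuous_ofReal.continuousAt.eventually (gt_mem_nhds htα)
    obtain ⟨r, ⟨har, hrα⟩, htr⟩ := (h1.and self_mem_nhdsWithin).exists
    have htr' : 0 < r - t := sub_pos.2 htr
    have h2 := (h r (ht.trans htr) hrα.le).sub (h t ht htα.le)
    -- The difference quotient of Φ_x on [t, r] exceeds `a`; that of Φ_{u n} eventually does too,
    -- and it bounds `rr (u n) t` from below.
    have h3 : (r - t) * a < prim x r - prim x t :=
      (mul_lt_mul_of_pos_left har htr').trans_le (hx.mul_rr_le ht.le (le_of_lt htr))
    filter_upwards [h2.eventually (lt_mem_nhds h3)] with n hn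
    exact lt_of_mul_lt_mul_left (hn.trans_le ((hu n).le_mul_rr ht (le_of_lt htr))) htr'.le
  · intro a ha
    have h1 : ∀ᶠ r in 𝓝[<] t, rr x r < a ∧ 0 < r :=
      ((hcont.eventually (gt_mem_nhds ha)).and (lt_mem_nhds ht)).filter_mono nhdsWithin_le_nhds
    obtain ⟨r, ⟨har, hr0⟩, hrt⟩ := (h1.and self_mem_nhdsWithin).exists
    have hrt' : 0 < t - r := sub_pos.2 hrt
    have h2 := (h t ht htα.le).sub
      (h r hr0 ((ENNReal.ofReal_le_ofReal (le_of_lt hrt)).trans htα.le))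
    have h3 : prim x t - prim x r < (t - r) * a :=
      (hx.le_mul_rr hr0 (le_of_lt hrt)).trans_lt (mul_lt_mul_of_pos_left har hrt')
    filter_upwards [h2.eventually (gt_mem_nhds h3)] with n hn
    exact lt_of_mul_lt_mul_left (((hu n).mul_rr_le hr0.le (le_of_lt hrt)).trans_lt hn) hrt'.le

lemma LocInt.ae_continuousAt_rr {x : L0 α} (hx : LocInt x) :
    ∀ᵐ t ∂(leb α), ContinuousAt (rr x) t := by
  have h1 : ∀ᵐ t ∂(leb α), ContinuousAt (rearr x) t := by
    refine ae_restrict_of_ae ?_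
    filter_upwards [(rearr_antitone x).countable_not_continuousAt.ae_notMem volume] with t ht
    exact not_not.1 ht
  filter_upwards [h1, ae_leb_pos] with t ht ht0
  exact (ENNReal.tendsto_toReal (hx.rearr_lt_top ht0).ne).comp ht

lemma edist_eq_edist_toReal {a b : ℝ≥0∞} (ha : a ≠ ∞) (hb : b ≠ ∞) :
    edist a b = edist a.toReal b.toReal := by
  lift a to ℝ≥0 using ha
  lift b to ℝ≥0 using hb
  rfl

/-- A.e. convergence together with uniform smallness of the tails gives convergence in measure. -/
lemma tendstoInMeasure_of_tail {f : ℕ → ℝ → ℝ≥0∞} {g : ℝ → ℝ≥0∞} (hfm : ∀ n, Measurable (f n))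
    (hf : ∀ n t, 0 < t → f n t ≠ ∞) (hg : ∀ t, 0 < t → g t ≠ ∞)
    (hlim : ∀ᵐ t ∂(leb α), Tendsto (fun n => (f n t).toReal) atTop (𝓝 (g t).toReal))
    (htail : ∀ ε : ℝ, 0 < ε → ∃ T : ℝ, ∀ n, ∀ t ∈ I α, T ≤ t →
      |(f n t).toReal - (g t).toReal| < ε) :
    TendstoInMeasure (leb α) f atTop g := by
  intro ε hε
  -- A real level strictly below `ε`, since `ε` may be `∞`.
  obtain ⟨r, hr0, hrε⟩ := ENNReal.lt_iff_exists_nnreal_btwn.1 hε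
  have hr0' : (0 : ℝ) < r := by exact_mod_cast hr0
  obtain ⟨T, hT⟩ := htail r hr0'
  set μ := (leb α).restrict (Set.Iio T) with hμ
  have hfin : IsFiniteMeasure μ := by
    refine ⟨?_⟩
    rw [hμ, Measure.restrict_apply_univ]
    calc leb α (Set.Iio T) ≤ leb α (Set.Ioo 0 T) :=
          measure_mono_ae (by filter_upwards [ae_leb_pos] with t ht hT using ⟨ht, hT⟩)
      _ ≤ volume (Set.Ioo 0 T) := Measure.restrict_apply_le _ _
      _ < ∞ := by simp
  have h1 : TendstoInMeasure μ (fun n t => (f n t).toReal) atTop fun t => (g t).toReal :=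
    tendstoInMeasure_of_tendsto_ae
      (fun n => (hfm n).ennreal_toReal.aestronglyMeasurable) (ae_restrict_of_ae hlim)
  refine tendsto_of_tendsto_of_tendsto_of_le_of_le tendsto_const_nhds (h1 r hr0)
    (fun _ => zero_le) fun n => ?_
  have hset : ∀ᵐ t ∂(leb α), ε ≤ edist (f n t) (g t) →
      t ∈ {t | (r : ℝ≥0∞) ≤ edist (f n t).toReal (g t).toReal} ∩ Set.Iio T := by
    filter_upwards [ae_leb_pos, ae_leb_mem] with t ht0 htI hεt
    rw [edist_eq_edist_toReal (hf n t ht0) (hg t ht0)] at hεt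
    have h2 : (r : ℝ≥0∞) < edist (f n t).toReal (g t).toReal := hrε.trans_le hεt
    refine ⟨h2.le, ?_⟩
    by_contra hc
    have h3 := hT n t htI (not_lt.1 hc)
    rw [edist_dist, Real.dist_eq, ← ENNReal.ofReal_coe_nnreal,
      ENNReal.ofReal_lt_ofReal_iff_of_nonneg hr0'.le] at h2
    exact lt_asymm h2 h3
  calc leb α {t | ε ≤ edist (f n t) (g t)}
      ≤ leb α ({t | (r : ℝ≥0∞) ≤ edist (f n t).toReal (g t).toReal} ∩ Set.Iio T) :=
        measure_mono_ae hset
    _ = _ := (Measure.restrict_apply' measurableSet_Iio).symm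

lemma toReal_maximal (x : L0 α) {t : ℝ} (ht : 0 < t) : (maximal x t).toReal = prim x t / t := by
  rw [maximal, ENNReal.toReal_div, ENNReal.toReal_ofReal ht.le, prim, rearrInt]

lemma LocInt.maximal_ne_top {x : L0 α} (hx : LocInt x) {t : ℝ} (ht : 0 < t) :
    maximal x t ≠ ∞ :=
  ENNReal.div_ne_top (hx t).ne (ENNReal.ofReal_pos.2 ht).ne'

lemma measurable_maximal (x : L0 α) : Measurable (maximal x) :=
  (rearrInt_mono x).measurable.div ENNReal.measurable_ofReal

lemma LocInt.rr_le_prim_div {x : L0 α} (hx : LocInt x) {t : ℝ} (ht : 0 < t) :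
    rr x t ≤ prim x t / t := by
  have h := hx.mul_rr_le le_rfl ht.le
  rw [prim_zero, sub_zero, sub_zero] at h
  rwa [le_div_iff₀' ht]

/-- The maximal function vanishes at infinity if the rearrangement does. -/
lemma LocInt.exists_prim_div_lt (hα : α = 1 ∨ α = ∞) {x : L0 α} (hx : LocInt x)
    (hx0 : RearrVanishesAtInfinity x) {ε : ℝ} (hε : 0 < ε) :
    ∃ T : ℝ, 0 < T ∧ ∀ t ∈ I α, T ≤ t → prim x t / t < ε := by
  rcases hα with rfl | rfl
  · refine ⟨1, one_pos, fun t ht h => ?_⟩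
    have : t < 1 := by simpa using ht.2
    exact absurd h (not_le.2 this)
  · have h1 := (hx0 rfl).eventually (gt_mem_nhds (ENNReal.ofReal_pos.2 (half_pos hε)))
    obtain ⟨s, hs, hs0⟩ := (h1.and (eventually_gt_atTop 0)).exists
    have hs' : rr x s < ε / 2 := by
      rw [← hx.ofReal_rr hs0] at hs
      exact (ENNReal.ofReal_lt_ofReal_iff (half_pos hε)).1 hs
    -- Beyond this point Φ_x(s)/t ≤ ε/2, and the growth after `s` has slope below ε/2.
    refine ⟨max s (2 * prim x s / ε), lt_max_of_lt_left hs0, fun t _ ht => ?_⟩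
    have hst : s ≤ t := (le_max_left _ _).trans ht
    have h2 : 2 * prim x s ≤ t * ε := by
      rw [← div_le_iff₀ hε]; exact (le_max_right _ _).trans ht
    rw [div_lt_iff₀ (hs0.trans_le hst)]
    have h3 := hx.le_mul_rr hs0 hst
    have h4 := mul_le_mul_of_nonneg_left hs'.le (sub_nonneg.2 hst)
    nlinarith [mul_pos hs0 hε]

end SymSpace

/-! ### Conclusion -/

theorem mainTheorem3 (α : ℝ≥0∞) (hα : α = 1 ∨ α = ∞)
    (E : SymSpace.BanachFunctionSpace α) (hsymm : E.IsSymmetric) (hfatou : E.HasFatouProperty)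
    (x : E.carrier) (hx : E.IsLKMPoint x)
    (hx0 : SymSpace.RearrVanishesAtInfinity (x : SymSpace.L0 α))
    (u : ℕ → E.carrier)
    (hu : ∀ n, SymSpace.HLP (u n : SymSpace.L0 α) (x : SymSpace.L0 α))
    (hnorm : Tendsto (fun n => E.nrm (u n)) atTop (𝓝 (E.nrm x))) :
    TendstoInMeasure (SymSpace.leb α) (fun n => SymSpace.maximal (u n : SymSpace.L0 α)) atTop
        (SymSpace.maximal (x : SymSpace.L0 α)) ∧
      TendstoInMeasure (SymSpace.leb α) (fun n => SymSpace.rearr (u n : SymSpace.L0 α)) atTop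
        (SymSpace.rearr (x : SymSpace.L0 α)) := by
  open SymSpace in
  have hxL : LocInt (x : L0 α) := hx.locInt hα hx0
  have huL : ∀ n, LocInt (u n : L0 α) := fun n => hxL.of_hlp (hu n)
  have hprim : ∀ t : ℝ, 0 < t → ENNReal.ofReal t ≤ α →
      Tendsto (fun n => prim (u n : L0 α) t) atTop (𝓝 (prim (x : L0 α) t)) := fun t ht htα =>
    tendsto_prim hα hsymm hfatou hx hxL hu hnorm ht htα
  have hmax : ∀ n t, 0 < t → prim (u n : L0 α) t / t ≤ prim (x : L0 α) t / t := fun n t ht =>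
    div_le_div_of_nonneg_right (hxL.prim_le (hu n) ht) ht.le
  constructor
  · refine tendstoInMeasure_of_tail (fun n => measurable_maximal _)
      (fun n t ht => (huL n).maximal_ne_top ht) (fun t ht => hxL.maximal_ne_top ht) ?_ ?_
    · filter_upwards [ae_leb_pos, ae_leb_mem] with t ht htI
      simp only [toReal_maximal _ ht]
      exact (hprim t ht htI.2.le).div_const t
    · intro ε hε
      obtain ⟨T, hT0, hT⟩ := hxL.exists_prim_div_lt hα hx0 hε
      refine ⟨T, fun n t htI ht => ?_⟩
      have ht0 := hT0.trans_le ht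
      rw [toReal_maximal _ ht0, toReal_maximal _ ht0]
      have h1 := hmax n t ht0
      have h2 := hT t htI ht
      have h3 : 0 ≤ prim (u n : L0 α) t / t := div_nonneg (prim_nonneg _ _) ht0.le
      rw [abs_lt]
      constructor <;> linarith
  · refine tendstoInMeasure_of_tail (fun n => measurable_rearr _)
      (fun n t ht => ((huL n).rearr_lt_top ht).ne) (fun t ht => (hxL.rearr_lt_top ht).ne) ?_ ?_
    · filter_upwards [ae_leb_pos, ae_leb_mem, hxL.ae_continuousAt_rr] with t ht htI hcont
      exact tendsto_rr_of_tendsto_prim hxL huL hprim ht htI.2 hcont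
    -- Both rearrangements lie in [0, x**(t)], so they differ by less than `ε` once x**(t) < ε.
    · intro ε hε
      obtain ⟨T, hT0, hT⟩ := hxL.exists_prim_div_lt hα hx0 hε
      refine ⟨T, fun n t htI ht => ?_⟩
      have ht0 := hT0.trans_le ht
      change |rr (u n : L0 α) t - rr (x : L0 α) t| < ε
      have h1 := hmax n t ht0
      have h2 := hT t htI ht
      have h3 := rr_nonneg (u n : L0 α) t
      have h4 := rr_nonneg (x : L0 α) t
      have h5 := (huL n).rr_le_prim_div ht0
      have h6 := hxL.rr_le_prim_div ht0
      rw [abs_lt]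
      constructor <;> linarith
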